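/- Let $F:\mathbf{Set}\to\mathbf{Set}$ be a functor that is nontrivial ($FX=\emptyset$ implies $X=\emptyset$), weakly preserves pullbacks (it sends pullback squares to weak pullback squares), and is either bounded (there is a cardinal $\kappa$ such that every element of every $F$-coalgebra lies in a subcoalgebra of cardinality at most $\kappa$) or accessible (it preserves $\kappa$-filtered colimits for some regular cardinal $\kappa$). Then the category $\mathbf{Set}_F$ of $F$-coalgebras has finite limits. Let $\mathbf{Pfn}_F$ be the category whose objects are the $F$-coalgebras and whose morphisms $X\dashrightarrow Y$ are the equivalence classes $\{m,\varphi\}$ of pairs of coalgebra morphisms $m:U\rightarrowtail X$ (a monomorphism of $\mathbf{Set}_F$) and $\varphi:U\to Y$, two pairs being equivalent if they differ by an isomorphism of their sources; composition is by pullback. Put $X\boxtimes Y=X\times Y$ (the product of $\mathbf{Set}_F$) and $\{m,\varphi\}\boxtimes\{m',\varphi'\}=\{m\times m',\varphi\times\varphi'\}$, with the diagonals $\Delta$ and projections $p_0,p_1$ of the product of $\mathbf{Set}_F$ regarded as total partial morphisms. In a category with such data, put $\langle f,g\rangle=(f\boxtimes g)\Delta$. It is a *P-category* if $\boxtimes$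 is a functor, $\Delta$ is natural, $p_i\Delta_X=1_X$, $(p_0\boxtimes p_1)\Delta_{X\boxtimes Y}=1_{X\boxtimes Y}$, $p_0$ is natural with respect to all pairs $(f,g)$, and $p_1$ with respect to all pairs $(g,f)$, where $f$ is arbitrary and $g$ lies in the smallest subcategory that is closed under $\boxtimes$ and contains all projections $p_i$, and the morphisms $\langle p_0p_0,\langle p_1p_0,p_1\rangle\rangle:(X\boxtimes Y)\boxtimes Z\to X\boxtimes(Y\boxtimes Z)$ and $\langle p_1,p_0\rangle:X\boxtimes Y\to Y\boxtimes X$ are coherent natural isomorphisms (pentagon, hexagon, the second being inverse to itself). It is a *PΣ-category* if moreover it has binary coproducts and coproducts of sequences, and the canonical morphisms $(X\boxtimes Y)\amalg(X\boxtimes Z)\to X\boxtimes(Y\amalg Z)$ and $\coprod_{n\in\mathbb N}(X\boxtimes Y_n)\to X\boxtimes\coprod_{n\in\mathbb N}Y_n$ are isomorphisms. The *domain* of $\phi:X\to Y$ is $p_0\langle 1_X,\phi\rangle:X\to X$, and $\mathrm{dom}(X)$ is the set of domains of morphisms with source $X$. A morphism $\phi:X\to Y$ has *range* $\varepsilon\in\mathrm{dom}(Y)$,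 written $\mathrm{ran}\,\phi=\varepsilon$, if $\varepsilon\phi=\phi$ and, for all $\psi,\psi'$ with source $Y$ and common target, $\psi\phi=\psi'\phi$ implies $\psi\varepsilon=\psi'\varepsilon$. An *rPΣ-category* is a PΣ-category in which every morphism has a range and $\mathrm{ran}(\phi\boxtimes\psi)=\mathrm{ran}\,\phi\boxtimes\mathrm{ran}\,\psi$ for all $\phi,\psi$. **Proposition.** $\mathbf{Pfn}_F$, with the above data, is an rPΣ-category. Moreover, for every $F$-coalgebra $X$, the set $\mathrm{dom}(X)$ is a lattice with meet $\varepsilon\wedge\delta=\varepsilon\circ\delta$ and join $\varepsilon\vee\delta=\mathrm{ran}[\varepsilon,\delta]$, where $[\varepsilon,\delta]:X\amalg X\to X$ is the copairing, and the map sending $\{m,\varphi\}\in\mathrm{dom}(X)$ to the image of $m$ is a lattice isomorphism from $\mathrm{dom}(X)$ onto the lattice of subcoalgebras of $X$ ordered by inclusion (in which meets are intersections and joins are unions); its inverse sends a subcoalgebra $U$ with inclusion $i:U\hookrightarrow X$ to the domain of $\{i,i\}$. -/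

import Mathlib

open CategoryTheory CategoryTheory.Limits

universe v u

namespace CoalgPfn

/-! ### Partial maps in a category with finite limits -/

section PartialMaps

variable {C : Type u} [Category.{v} C]

/-- A partial map `(m, φ)` from `X` to `Y`: a monomorphism `m : U ⟶ X` together with a
morphism `φ : U ⟶ Y`.  (The dominion is the class of all monomorphisms.) -/
structure PartialMap (X Y : C) where
  /-- the domain of definition `U` -/
  dom : C
  /-- the monomorphism `m : U ⟶ X` -/
  incl : dom ⟶ X
  /-- the morphism `φ : U ⟶ Y` -/
  map : dom ⟶ Y
  mono : Mono incl

attribute [instance] PartialMap.mono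

namespace PartialMap

/-- `(m, φ)` and `(m', φ')` are equivalent if an isomorphism `θ : U ≅ U'` commutes with the
legs to `X` and to `Y`. -/
def Equivalent {X Y : C} (f g : PartialMap X Y) : Prop :=
  ∃ θ : f.dom ≅ g.dom, θ.hom ≫ g.incl = f.incl ∧ θ.hom ≫ g.map = f.map

instance setoid (X Y : C) : Setoid (PartialMap X Y) where
  r := Equivalent
  iseqv :=
    { refl := fun f => ⟨Iso.refl _, by simp, by simp⟩
      symm := by
        rintro f g ⟨θ, h₁, h₂⟩
        exact ⟨θ.symm, by simp [← h₁], by simp [← h₂]⟩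
      trans := by
        rintro f g h ⟨θ, h₁, h₂⟩ ⟨θ', h₁', h₂'⟩
        exact ⟨θ ≪≫ θ', by simp [h₁, h₁'], by simp [h₂, h₂']⟩ }

/-- To see that two partial maps are equivalent it suffices to compare them in both directions. -/
lemma equivalent_of {X Y U V : C} {m : U ⟶ X} {φ : U ⟶ Y} {n : V ⟶ X} {ψ : V ⟶ Y}
    {hm : Mono m} {hn : Mono n} (a : U ⟶ V) (b : V ⟶ U)
    (ha : a ≫ n = m) (hb : b ≫ m = n) (h : a ≫ ψ = φ) :
    Equivalent ⟨U, m, φ, hm⟩ ⟨V, n, ψ, hn⟩ :=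
  ⟨⟨a, b, by rw [← cancel_mono m]; simp [ha, hb],
    by rw [← cancel_mono n]; simp [ha, hb]⟩, ha, h⟩

/-- The identity `(1, 1)`. -/
abbrev id (X : C) : PartialMap X X := ⟨X, 𝟙 X, 𝟙 X, inferInstance⟩

variable [HasFiniteLimits C]

/-- The composite of partial maps, formed with the pullback of `φ` along `m'`. -/
noncomputable abbrev comp {X Y Z : C} (f : PartialMap X Y) (g : PartialMap Y Z) :
    PartialMap X Z :=
  ⟨pullback f.map g.incl, pullback.fst f.map g.incl ≫ f.incl,
    pullback.snd f.map g.incl ≫ g.map, inferInstance⟩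

/-- The product `(m × m', φ × φ')`. -/
noncomputable abbrev prod {X Y X' Y' : C} (f : PartialMap X Y) (g : PartialMap X' Y') :
    PartialMap (X ⨯ X') (Y ⨯ Y') :=
  ⟨f.dom ⨯ g.dom, prod.map f.incl g.incl, prod.map f.map g.map, inferInstance⟩

lemma comp_equivalent {X Y Z : C} {f f' : PartialMap X Y} {g g' : PartialMap Y Z}
    (hf : f.Equivalent f') (hg : g.Equivalent g') :
    (f.comp g).Equivalent (f'.comp g') := by
  obtain ⟨θ, h₁, h₂⟩ := hf
  obtain ⟨η, k₁, k₂⟩ := hg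
  have h₁' : θ.inv ≫ f.incl = f'.incl := by simp [← h₁]
  have h₂' : θ.inv ≫ f.map = f'.map := by simp [← h₂]
  have k₁' : η.inv ≫ g.incl = g'.incl := by simp [← k₁]
  refine equivalent_of
    (pullback.lift (pullback.fst f.map g.incl ≫ θ.hom) (pullback.snd f.map g.incl ≫ η.hom) ?_)
    (pullback.lift (pullback.fst f'.map g'.incl ≫ θ.inv) (pullback.snd f'.map g'.incl ≫ η.inv) ?_)
    ?_ ?_ ?_
  · simp only [Category.assoc, h₂, k₁, pullback.condition]
  · simp only [Category.assoc, h₂', k₁', pullback.condition]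
  · rw [pullback.lift_fst_assoc, Category.assoc, h₁]
  · rw [pullback.lift_fst_assoc, Category.assoc, h₁']
  · rw [pullback.lift_snd_assoc, Category.assoc, k₂]

lemma prod_equivalent {X Y X' Y' : C} {f f' : PartialMap X Y} {g g' : PartialMap X' Y'}
    (hf : f.Equivalent f') (hg : g.Equivalent g') :
    (f.prod g).Equivalent (f'.prod g') := by
  obtain ⟨θ, h₁, h₂⟩ := hf
  obtain ⟨η, k₁, k₂⟩ := hg
  exact ⟨prod.mapIso θ η, by simp [h₁, k₁], by simp [h₂, k₂]⟩

lemma id_comp {X Y : C} (f : PartialMap X Y) : ((id X).comp f).Equivalent f :=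
  equivalent_of (pullback.snd (𝟙 X) f.incl)
    (pullback.lift f.incl (𝟙 f.dom) (by simp))
    (by simpa using (pullback.condition (f := 𝟙 X) (g := f.incl)).symm)
    (by simp [pullback.lift_fst]) rfl

lemma comp_id {X Y : C} (f : PartialMap X Y) : (f.comp (id Y)).Equivalent f :=
  equivalent_of (pullback.fst f.map (𝟙 Y))
    (pullback.lift (𝟙 f.dom) f.map (by simp))
    rfl (by rw [pullback.lift_fst_assoc, Category.id_comp])
    (by simpa using pullback.condition (f := f.map) (g := 𝟙 Y))

lemma comp_assoc {W X Y Z : C} (f : PartialMap W X) (g : PartialMap X Y) (h : PartialMap Y Z) :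
    ((f.comp g).comp h).Equivalent (f.comp (g.comp h)) := by
  have e₁ := pullback.condition (f := f.map) (g := g.incl)
  have e₂ := pullback.condition (f := g.map) (g := h.incl)
  have e₃ := pullback.condition (f := pullback.snd f.map g.incl ≫ g.map) (g := h.incl)
  have e₄ := pullback.condition (f := f.map) (g := pullback.fst g.map h.incl ≫ g.incl)
  refine equivalent_of
    (pullback.lift (pullback.fst _ h.incl ≫ pullback.fst f.map g.incl)
      (pullback.lift (pullback.fst _ h.incl ≫ pullback.snd f.map g.incl)
        (pullback.snd _ h.incl) ?_) ?_)
    (pullback.lift (pullback.lift (pullback.fst f.map _)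
      (pullback.snd f.map _ ≫ pullback.fst g.map h.incl) ?_)
      (pullback.snd f.map _ ≫ pullback.snd g.map h.incl) ?_) ?_ ?_ ?_
  · simpa using e₃
  · simp only [Category.assoc, pullback.lift_fst_assoc, e₁]
  · simpa using e₄
  · simp only [Category.assoc, pullback.lift_snd_assoc, e₂]
  · rw [pullback.lift_fst_assoc]; simp only [Category.assoc]
  · rw [pullback.lift_fst_assoc, pullback.lift_fst_assoc]
  · rw [pullback.lift_snd_assoc, pullback.lift_snd_assoc]

end PartialMap

end PartialMaps

/-- The category of partial maps of `C`: its objects are those of `C`. -/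
structure Par (C : Type u) where
  /-- the underlying object -/
  of : C

namespace Par

variable {C : Type u} [Category.{v} C] [HasFiniteLimits C]

/-- The morphisms of `Par C` are the equivalence classes `{m, φ}` of partial maps. -/
noncomputable instance : Category (Par C) where
  Hom X Y := Quotient (PartialMap.setoid X.of Y.of)
  id X := Quotient.mk _ (PartialMap.id X.of)
  comp f g := Quotient.map₂ PartialMap.comp
    (fun _ _ hf _ _ hg => PartialMap.comp_equivalent hf hg) f g
  id_comp := by rintro X Y ⟨f⟩; exact Quotient.sound f.id_comp
  comp_id := by rintro X Y ⟨f⟩; exact Quotient.sound f.comp_id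
  assoc := by rintro W X Y Z ⟨f⟩ ⟨g⟩ ⟨h⟩; exact Quotient.sound (f.comp_assoc g h)

/-- The partial morphism `{m, φ}`. -/
def homMk {X Y : Par C} {U : C} (m : U ⟶ X.of) [Mono m] (φ : U ⟶ Y.of) : X ⟶ Y :=
  Quotient.mk (PartialMap.setoid X.of Y.of) ⟨U, m, φ, inferInstance⟩

/-- The total morphism `{1, φ}` given by a morphism `φ` of `C`. -/
def total {X Y : Par C} (φ : X.of ⟶ Y.of) : X ⟶ Y := homMk (𝟙 X.of) φ

end Par

/-! ### P-categories -/

/-- The data of a P-category: a product on objects and morphisms, diagonals and two families of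
projections. -/
structure NearProduct (C : Type u) [Category.{v} C] where
  /-- `X ⊠ Y` -/
  obj : C → C → C
  /-- `f ⊠ g` -/
  map : ∀ {X X' Y Y' : C}, (X ⟶ X') → (Y ⟶ Y') → (obj X Y ⟶ obj X' Y')
  /-- `Δ_X` -/
  diag : ∀ X : C, X ⟶ obj X X
  /-- the projection `p₀` -/
  fst : ∀ X Y : C, obj X Y ⟶ X
  /-- the projection `p₁` -/
  snd : ∀ X Y : C, obj X Y ⟶ Y

namespace NearProduct

variable {C : Type u} [Category.{v} C] (P : NearProduct C)

/-- `⟨f, g⟩ = (f ⊠ g) Δ`. -/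
def pair {X Y Z : C} (f : X ⟶ Y) (g : X ⟶ Z) : X ⟶ P.obj Y Z :=
  P.diag X ≫ P.map f g

/-- The associativity morphism `⟨p₀ p₀, ⟨p₁ p₀, p₁⟩⟩ : (X ⊠ Y) ⊠ Z ⟶ X ⊠ (Y ⊠ Z)`. -/
def ass (X Y Z : C) : P.obj (P.obj X Y) Z ⟶ P.obj X (P.obj Y Z) :=
  P.pair (P.fst (P.obj X Y) Z ≫ P.fst X Y)
    (P.pair (P.fst (P.obj X Y) Z ≫ P.snd X Y) (P.snd (P.obj X Y) Z))

/-- The transposition `⟨p₁, p₀⟩ : X ⊠ Y ⟶ Y ⊠ X`. -/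
def tr (X Y : C) : P.obj X Y ⟶ P.obj Y X :=
  P.pair (P.snd X Y) (P.fst X Y)

/-- The morphisms of the smallest subcategory that is closed under `⊠` and contains all
components of the projections. -/
inductive Proj : ∀ {X Y : C}, (X ⟶ Y) → Prop
  | id (X : C) : Proj (𝟙 X)
  | comp {X Y Z : C} (f : X ⟶ Y) (g : Y ⟶ Z) : Proj f → Proj g → Proj (f ≫ g)
  | map {X X' Y Y' : C} (f : X ⟶ X') (g : Y ⟶ Y') : Proj f → Proj g → Proj (P.map f g)
  | fst (X Y : C) : Proj (P.fst X Y)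
  | snd (X Y : C) : Proj (P.snd X Y)

/-- The axioms of a P-category. -/
structure IsPCategory : Prop where
  /-- `⊠` is a functor -/
  map_id : ∀ X Y : C, P.map (𝟙 X) (𝟙 Y) = 𝟙 (P.obj X Y)
  map_comp : ∀ {X X' X'' Y Y' Y'' : C} (f : X ⟶ X') (f' : X' ⟶ X'') (g : Y ⟶ Y')
    (g' : Y' ⟶ Y''), P.map (f ≫ f') (g ≫ g') = P.map f g ≫ P.map f' g'
  /-- `Δ` is natural -/
  diag_natural : ∀ {X Y : C} (f : X ⟶ Y), f ≫ P.diag Y = P.diag X ≫ P.map f f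
  diag_fst : ∀ X : C, P.diag X ≫ P.fst X X = 𝟙 X
  diag_snd : ∀ X : C, P.diag X ≫ P.snd X X = 𝟙 X
  diag_map : ∀ X Y : C, P.diag (P.obj X Y) ≫ P.map (P.fst X Y) (P.snd X Y) = 𝟙 (P.obj X Y)
  /-- `p₀` is natural on pairs whose second member is generated by projections -/
  fst_natural : ∀ {X X' Y Y' : C} (f : X ⟶ X') (g : Y ⟶ Y'), P.Proj g →
    P.map f g ≫ P.fst X' Y' = P.fst X Y ≫ f
  /-- `p₁` is natural on pairs whose first member is generated by projections -/
  snd_natural : ∀ {X X' Y Y' : C} (f : X ⟶ X') (g : Y ⟶ Y'), P.Proj f →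
    P.map f g ≫ P.snd X' Y' = P.snd X Y ≫ g
  /-- associativity is a natural isomorphism -/
  ass_natural : ∀ {X X' Y Y' Z Z' : C} (f : X ⟶ X') (g : Y ⟶ Y') (h : Z ⟶ Z'),
    P.map (P.map f g) h ≫ P.ass X' Y' Z' = P.ass X Y Z ≫ P.map f (P.map g h)
  ass_isIso : ∀ X Y Z : C, IsIso (P.ass X Y Z)
  /-- transposition is a natural isomorphism, with inverse transposition -/
  tr_natural : ∀ {X X' Y Y' : C} (f : X ⟶ X') (g : Y ⟶ Y'),
    P.map f g ≫ P.tr X' Y' = P.tr X Y ≫ P.map g f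
  tr_tr : ∀ X Y : C, P.tr X Y ≫ P.tr Y X = 𝟙 (P.obj X Y)
  /-- coherence -/
  pentagon : ∀ W X Y Z : C,
    P.map (P.ass W X Y) (𝟙 Z) ≫ P.ass W (P.obj X Y) Z ≫ P.map (𝟙 W) (P.ass X Y Z) =
      P.ass (P.obj W X) Y Z ≫ P.ass W X (P.obj Y Z)
  hexagon : ∀ X Y Z : C,
    P.ass X Y Z ≫ P.tr X (P.obj Y Z) ≫ P.ass Y Z X =
      P.map (P.tr X Y) (𝟙 Z) ≫ P.ass Y X Z ≫ P.map (𝟙 Y) (P.tr X Z)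

/-- A PΣ-category: a P-category with binary and countable coproducts over which `⊠`
distributes, i.e. the canonical natural transformations
`(X ⊠ Y) ⨿ (X ⊠ Z) ⟶ X ⊠ (Y ⨿ Z)` and `∐ (X ⊠ Y n) ⟶ X ⊠ ∐ Y n` are invertible. -/
structure IsPSigmaCategory : Prop extends P.IsPCategory where
  [hasBinaryCoproducts : HasBinaryCoproducts C]
  [hasCountableCoproducts : HasCoproductsOfShape ℕ C]
  dist_isIso : ∀ X Y Z : C, IsIso (coprod.desc (P.map (𝟙 X) (coprod.inl : Y ⟶ Y ⨿ Z))
    (P.map (𝟙 X) (coprod.inr : Z ⟶ Y ⨿ Z)))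
  distSigma_isIso : ∀ (X : C) (Y : ℕ → C),
    IsIso (Sigma.desc fun n => P.map (𝟙 X) (Sigma.ι Y n))

/-- The domain `p₀ ⟨1, φ⟩ : X ⟶ X` of a morphism `φ : X ⟶ Y`. -/
def domain {X Y : C} (φ : X ⟶ Y) : X ⟶ X := P.pair (𝟙 X) φ ≫ P.fst X Y

/-- `ε` belongs to `dom(X)`, the set of domains of morphisms with source `X`. -/
def IsDomain {X : C} (ε : X ⟶ X) : Prop := ∃ (Y : C) (φ : X ⟶ Y), ε = P.domain φ

/-- `dom(X)`. -/
def Dom (X : C) := {ε : X ⟶ X // P.IsDomain ε}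

/-- `ran φ = ε`: the domain `ε` on `Y` satisfies `ε φ = φ`, and `ψ φ = ψ' φ` implies
`ψ ε = ψ' ε`. -/
structure IsRange {X Y : C} (φ : X ⟶ Y) (ε : Y ⟶ Y) : Prop where
  isDomain : P.IsDomain ε
  comp_eq : φ ≫ ε = φ
  cancel : ∀ {Z : C} (ψ ψ' : Y ⟶ Z), φ ≫ ψ = φ ≫ ψ' → ε ≫ ψ = ε ≫ ψ'

/-- An rPΣ-category: a PΣ-category in which every morphism has a range and
`ran (φ ⊠ ψ) = ran φ ⊠ ran ψ`. -/
structure IsRPSigmaCategory : Prop extends P.IsPSigmaCategory where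
  exists_range : ∀ {X Y : C} (φ : X ⟶ Y), ∃ ε : Y ⟶ Y, P.IsRange φ ε
  range_map : ∀ {X Y X' Y' : C} (φ : X ⟶ Y) (ψ : X' ⟶ Y') (ε : Y ⟶ Y) (δ : Y' ⟶ Y'),
    P.IsRange φ ε → P.IsRange ψ δ → P.IsRange (P.map φ ψ) (P.map ε δ)

/-- `[f, g] = ∇ (f ⨿ g)`. -/
noncomputable def IsRPSigmaCategory.copair {P : NearProduct C} (h : P.IsRPSigmaCategory)
    {X Y Z : C} (f : X ⟶ Z) (g : Y ⟶ Z) :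
    haveI := h.hasBinaryCoproducts
    X ⨿ Y ⟶ Z :=
  haveI := h.hasBinaryCoproducts
  coprod.desc f g

end NearProduct

/-- The near product on `Par C`: `X ⊠ Y = X × Y`, `{m, φ} ⊠ {m', φ'} = {m × m', φ × φ'}`, and the
diagonals and projections are those of the product of `C`. -/
noncomputable def Par.nearProduct (C : Type u) [Category.{v} C] [HasFiniteLimits C] :
    NearProduct (Par C) where
  obj X Y := ⟨X.of ⨯ Y.of⟩
  map f g := Quotient.map₂ PartialMap.prod
    (fun _ _ hf _ _ hg => PartialMap.prod_equivalent hf hg) f g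
  diag X := Par.total (Y := ⟨X.of ⨯ X.of⟩) (Limits.diag X.of)
  fst X Y := Par.total (X := ⟨X.of ⨯ Y.of⟩) prod.fst
  snd X Y := Par.total (X := ⟨X.of ⨯ Y.of⟩) prod.snd

/-! ### Coalgebras of an endofunctor of the category of sets -/

section Coalgebras

open Endofunctor

/-- `F` is nontrivial: `F X = ∅` implies `X = ∅`. -/
def IsNontrivial (F : Type u ⥤ Type u) : Prop :=
  ∀ X : Type u, IsEmpty (F.obj X) → IsEmpty X

/-- `F` weakly preserves pullbacks: it sends pullback squares to weak pullback squares. -/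
def WeaklyPreservesPullbacks (F : Type u ⥤ Type u) : Prop :=
  ∀ ⦃P X Y Z : Type u⦄ ⦃p : P ⟶ X⦄ ⦃q : P ⟶ Y⦄ ⦃f : X ⟶ Z⦄ ⦃g : Y ⟶ Z⦄
    (sq : IsPullback p q f g),
    Nonempty (IsWeakLimit (PullbackCone.mk (F.map p) (F.map q) (sq.toCommSq.map F).w))

variable {F : Type u ⥤ Type u}

/-- A subcoalgebra of `X`: a subset that carries a coalgebra structure (necessarily unique) for
which the inclusion is a morphism. -/
@[ext]
structure Subcoalgebra (X : Coalgebra F) where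
  /-- the underlying subset -/
  carrier : Set X.V
  exists_str : ∃ β : (carrier : Type u) ⟶ F.obj carrier,
    β ≫ F.map (TypeCat.ofHom (Subtype.val : carrier → X.V)) =
      TypeCat.ofHom (Subtype.val : carrier → X.V) ≫ X.str

namespace Subcoalgebra

variable {X : Coalgebra F}

/-- Subcoalgebras are ordered by inclusion. -/
instance : PartialOrder (Subcoalgebra X) :=
  PartialOrder.lift Subcoalgebra.carrier fun _ _ h => Subcoalgebra.ext h

/-- A subcoalgebra as a coalgebra. -/
noncomputable def toCoalgebra (U : Subcoalgebra X) : Coalgebra F :=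
  ⟨U.carrier, U.exists_str.choose⟩

/-- The inclusion of a subcoalgebra. -/
noncomputable def incl (U : Subcoalgebra X) : U.toCoalgebra ⟶ X :=
  { f := TypeCat.ofHom (Subtype.val : U.carrier → X.V)
    h := U.exists_str.choose_spec }

instance (U : Subcoalgebra X) : Mono U.incl :=
  (Coalgebra.forget F).mono_of_mono_map
    ((mono_iff_injective _).2 (Subtype.val_injective : Function.Injective _))

/-- The image of a morphism of coalgebras is a subcoalgebra of the codomain. -/
def image {V : Coalgebra F} (m : V ⟶ X) : Subcoalgebra X where
  carrier := Set.range m.f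
  exists_str := by
    let e : V.V → Set.range m.f := Set.rangeFactorization m.f
    have he : TypeCat.ofHom e ≫ TypeCat.ofHom (Subtype.val : Set.range m.f → X.V) = m.f := rfl
    choose s hs using fun y : Set.range m.f => y.2
    refine ⟨TypeCat.ofHom fun y => F.map (TypeCat.ofHom e) (V.str (s y)), ?_⟩
    ext y
    have h₁ : F.map (TypeCat.ofHom (Subtype.val : Set.range m.f → X.V))
        (F.map (TypeCat.ofHom e) (V.str (s y))) = F.map m.f (V.str (s y)) := by
      exact (ConcreteCategory.congr_hom (F.map_comp (TypeCat.ofHom e)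
        (TypeCat.ofHom (Subtype.val : Set.range m.f → X.V))) (V.str (s y))).symm
    have h₂ : F.map m.f (V.str (s y)) = X.str (m.f (s y)) := ConcreteCategory.congr_hom m.h (s y)
    exact h₁.trans (h₂.trans (by rw [hs y]; rfl))

end Subcoalgebra

/-- `F` is bounded: for some cardinal `κ`, each element of each coalgebra lies in a subcoalgebra of
cardinality at most `κ`. -/
def IsBounded (F : Type u ⥤ Type u) : Prop :=
  ∃ κ : Cardinal.{u}, ∀ (A : Coalgebra F) (a : A.V),
    ∃ U : Subcoalgebra A, a ∈ U.carrier ∧ Cardinal.mk U.carrier ≤ κ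

/-- The category of `F`-coalgebras and partial morphisms. -/
abbrev Pfn (F : Type u ⥤ Type u) := Par (Coalgebra F)

/-- The subcoalgebra of `X` on which a partial morphism `{m, φ}` is defined: the image of `m`. -/
def domSubcoalgebra [HasFiniteLimits (Coalgebra F)] {X Y : Pfn F} (φ : X ⟶ Y) :
    Subcoalgebra X.of :=
  Quotient.lift (s := PartialMap.setoid X.of Y.of) (fun f => Subcoalgebra.image f.incl)
    (by
      rintro f g ⟨θ, h, -⟩
      have h' : θ.inv ≫ f.incl = g.incl := by simp [← h]
      ext x
      constructor
      · rintro ⟨y, rfl⟩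
        exact ⟨θ.hom.f y, by rw [← h]; rfl⟩
      · rintro ⟨y, rfl⟩
        exact ⟨θ.inv.f y, by rw [← h']; rfl⟩) φ

end Coalgebras

end CoalgPfn

namespace CoalgPfn

open Endofunctor

/-! ### Limits of coalgebras of a bounded functor -/

section CoalgebraLimits

variable {F : Type u ⥤ Type u}

/-! Finite limits come from colimits. The forgetful functor to sets creates colimits, so
epimorphisms of coalgebras are surjective and quotients are determined by their kernels. Boundedness
supplies a small separating set, and the special adjoint functor theorem then yields all limits
(`IsBounded.hasFiniteLimits`). An accessible functor is bounded, because a small set can be closed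
under small supports of the structure map (`isBounded_of_isAccessible`).

The limits so obtained are not computed on underlying sets: a product of coalgebras is not in
general the product of sets. Weak preservation of pullbacks compensates for this. The set-theoretic
pullback of two homomorphisms carries some coalgebra structure, hence the pullback of coalgebras
maps onto it (`exists_of_isPullback`). It follows that monomorphisms are injective and that a
homomorphism factors through every monomorphism whose image contains its own (`exists_lift`). A
partial morphism is then determined by its graph, a partial function between underlying sets, and
composition is composition of relations (`graph_ext`, `graph_comp`).

The P-category axioms hold for partial maps in any category with finite limits; each reduces to a
pullback square of products (`isPCategory`). Coproducts are disjoint unions: any family of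
homomorphisms that decomposes a coalgebra into disjoint injective images is a coproduct of partial
morphisms (`isCoproduct_totalHom`), and such decompositions are stable under `A ⨯ -`
(`bijective_prodMap`). The range of `{m, φ}` is given by the image of `φ`. Ranges respect products
because products of surjective homomorphisms are surjective (`surjective_prodMap`). Finally, domains
have the form `{m, m}`, so they correspond to subcoalgebras, and the lattice structure is
transported along this bijection. -/

lemma hom_comp_str {A B : Coalgebra F} {Y : Type u} (f : A ⟶ B) (g : B.V ⟶ Y) :
    f.f ≫ B.str ≫ F.map g = A.str ≫ F.map (f.f ≫ g) := by
  rw [← Category.assoc, ← f.h, Category.assoc, F.map_comp]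

section Colimits

variable {J : Type u} [Category.{u} J] (K : J ⥤ Coalgebra F)
  {c : Cocone (K ⋙ Coalgebra.forget F)} (hc : IsColimit c)

/-- The coalgebra structure on a colimit of the underlying sets. -/
noncomputable def colimitStr : c.pt ⟶ F.obj c.pt :=
  hc.desc
    { pt := F.obj c.pt
      ι :=
        { app := fun j => (K.obj j).str ≫ F.map (c.ι.app j)
          naturality := fun _ j f => ((hom_comp_str (K.map f) (c.ι.app j)).trans
            (congrArg (fun t => _ ≫ F.map t) (c.w f))).trans (Category.comp_id _).symm } }

lemma ι_colimitStr (j : J) :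
    c.ι.app j ≫ colimitStr K hc = (K.obj j).str ≫ F.map (c.ι.app j) :=
  hc.fac _ j

/-- The cocone of coalgebras over a colimit cocone of the underlying sets. -/
noncomputable def colimitCocone : Cocone K where
  pt := ⟨c.pt, colimitStr K hc⟩
  ι :=
    { app := fun j => { f := c.ι.app j, h := (ι_colimitStr K hc j).symm }
      naturality := fun i j f => by
        ext1
        exact c.ι.naturality f }

/-- A colimit of the underlying sets is a colimit of coalgebras. -/
noncomputable def isColimitColimitCocone : IsColimit (colimitCocone K hc) where
  desc s :=
    { f := hc.desc ((Coalgebra.forget F).mapCocone s)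
      h := hc.hom_ext fun j => by
        have h₁ : c.ι.app j ≫ hc.desc ((Coalgebra.forget F).mapCocone s) = (s.ι.app j).f :=
          hc.fac ((Coalgebra.forget F).mapCocone s) j
        refine (hom_comp_str ((colimitCocone K hc).ι.app j) _).trans ?_
        refine (congrArg (fun t => (K.obj j).str ≫ F.map t) h₁).trans ?_
        exact (s.ι.app j).h.trans (congrArg (fun t => t ≫ s.pt.str) h₁.symm) }
  fac s j := by
    ext1
    exact hc.fac ((Coalgebra.forget F).mapCocone s) j
  uniq s m hm := by
    ext1
    exact hc.uniq ((Coalgebra.forget F).mapCocone s) m.f fun j =>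
      congrArg Coalgebra.Hom.f (hm j)

instance : HasColimits (Coalgebra F) where
  has_colimits_of_shape _ _ :=
    { has_colimit := fun K =>
        ⟨⟨_, isColimitColimitCocone K (colimit.isColimit (K ⋙ Coalgebra.forget F))⟩⟩ }

instance : PreservesColimits (Coalgebra.forget F) where
  preservesColimitsOfShape :=
    { preservesColimit := fun {K} => preservesColimit_of_preserves_colimit_cocone
        (isColimitColimitCocone K (colimit.isColimit (K ⋙ Coalgebra.forget F)))
        ((colimit.isColimit (K ⋙ Coalgebra.forget F)).ofIsoColimit (Cocone.ext (Iso.refl _))) }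

end Colimits

lemma hom_str {A B : Coalgebra F} (f : A ⟶ B) (a : A.V) : F.map f.f (A.str a) = B.str (f.f a) :=
  ConcreteCategory.congr_hom f.h a

/-- The forgetful functor preserves colimits, hence epimorphisms. -/
lemma surjective_of_epi {A B : Coalgebra F} (f : A ⟶ B) [Epi f] : Function.Surjective f.f :=
  (epi_iff_surjective _).1 (inferInstanceAs (Epi ((Coalgebra.forget F).map f)))

lemma mono_of_injective {A B : Coalgebra F} {f : A ⟶ B} (hf : Function.Injective f.f) : Mono f :=
  (Coalgebra.forget F).mono_of_mono_map ((mono_iff_injective _).2 hf)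

lemma hom_ext_apply {A B : Coalgebra F} {f g : A ⟶ B} (h : ∀ a, f.f a = g.f a) : f = g := by
  ext1; ext a; exact h a

lemma comp_apply {A B D : Coalgebra F} (f : A ⟶ B) (g : B ⟶ D) (a : A.V) :
    (f ≫ g).f a = g.f (f.f a) := rfl

/-- A homomorphism factors through any surjective homomorphism with a smaller kernel. -/
lemma exists_factor_of_surjective {A B D : Coalgebra F} (e : A ⟶ B) (f : A ⟶ D)
    (he : Function.Surjective e.f) (h : ∀ a a', e.f a = e.f a' → f.f a = f.f a') :
    ∃ g : B ⟶ D, e ≫ g = f := by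
  choose s hs using he
  have hg : e.f ≫ TypeCat.ofHom (fun b => f.f (s b)) = f.f := by
    ext a
    exact h _ _ (hs _)
  refine ⟨⟨TypeCat.ofHom fun b => f.f (s b), ?_⟩, by ext1; exact hg⟩
  ext b
  have h₁ := hom_str e (s b)
  have h₂ := hom_str f (s b)
  rw [hs] at h₁
  have h₃ := ConcreteCategory.congr_hom (F.map_comp e.f (TypeCat.ofHom fun b => f.f (s b)))
    (A.str (s b))
  rw [hg] at h₃
  change F.map _ (B.str b) = D.str (f.f (s b))
  rw [← h₁, ← h₂]
  exact h₃.symm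

instance : WellPowered.{u} (Coalgebra F)ᵒᵖ where
  subobject_small X := by
    -- A subobject in the opposite category is a quotient; it is recovered from its kernel relation,
    -- and there is only a small set of relations on `X`.
    let r (S : Subobject X) (a b : X.unop.V) : Prop := S.arrow.unop.f a = S.arrow.unop.f b
    have hle (S T : Subobject X) (h : r S = r T) : T ≤ S := by
      obtain ⟨g, hg⟩ := exists_factor_of_surjective S.arrow.unop T.arrow.unop
        (surjective_of_epi _) (fun a b hab => (congrFun₂ h a b).mp hab)
      exact Subobject.le_of_comm g.op (Quiver.Hom.unop_inj hg)
    exact small_of_injective (f := r) fun S T h => le_antisymm (hle T S h.symm) (hle S T h)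

/-- The coalgebras on subsets of a fixed set. -/
def coalgebrasOnSubsets (F : Type u ⥤ Type u) (K : Type u) : ObjectProperty (Coalgebra F) :=
  ObjectProperty.ofObj fun p : Σ s : Set K, ((s : Type u) ⟶ F.obj s) => (⟨p.1, p.2⟩ : Coalgebra F)

instance (K : Type u) : ObjectProperty.Small.{u} (coalgebrasOnSubsets F K) :=
  inferInstanceAs (ObjectProperty.Small.{u} (ObjectProperty.ofObj _))

lemma exists_iso_coalgebrasOnSubsets (A : Coalgebra F) {K : Type u} {i : A.V → K}
    (hi : Function.Injective i) : ∃ B : Coalgebra F, coalgebrasOnSubsets F K B ∧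
      Nonempty (B ≅ A) := by
  let e : (Set.range i : Type u) ≅ A.V := (Equiv.ofInjective i hi).symm.toIso
  refine ⟨⟨Set.range i, e.hom ≫ A.str ≫ F.map e.inv⟩,
    ObjectProperty.ofObj_apply _ (⟨Set.range i, _⟩ : Σ s : Set K, ((s : Type u) ⟶ F.obj s)),
    ⟨Coalgebra.isoMk e ?_⟩⟩
  simp [← F.map_comp]

/-- Two homomorphisms that differ at `a` already differ on a subcoalgebra of cardinality at most `κ`
containing `a`, and this has an isomorphic copy on a subset of `κ.out`. These copies therefore form
a small separating set, and cocompleteness with co-well-poweredness does the rest. -/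
theorem IsBounded.hasFiniteLimits (h : IsBounded F) : HasFiniteLimits (Coalgebra F) := by
  obtain ⟨κ, hκ⟩ := h
  have hsep : (coalgebrasOnSubsets F κ.out).IsSeparating := by
    intro A B f g hfg
    refine hom_ext_apply fun a => ?_
    obtain ⟨U, haU, hU⟩ := hκ A a
    rw [← Cardinal.mk_out κ, Cardinal.le_def] at hU
    obtain ⟨i⟩ := hU
    obtain ⟨G, hG, ⟨e⟩⟩ := exists_iso_coalgebrasOnSubsets U.toCoalgebra i.injective
    have h₁ := hfg G hG (e.hom ≫ U.incl)
    rw [Category.assoc, Category.assoc, cancel_epi] at h₁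
    exact ConcreteCategory.congr_hom (congrArg Coalgebra.Hom.f h₁) ⟨a, haU⟩
  have := hasLimits_of_hasColimits_of_isSeparating hsep
  infer_instance

end CoalgebraLimits

/-! ### Accessible functors are bounded -/

section Boundedness

open Cardinal

variable {F : Type u ⥤ Type u}

/-- Every set is the `κ`-filtered colimit of its subsets of cardinality less than `κ`, and `F`
preserves this colimit. -/
lemma exists_small_support (κ : Cardinal.{u}) [Fact κ.IsRegular] [F.IsCardinalAccessible κ]
    {X : Type u} (x : F.obj X) : ∃ S : Set X, #S ≤ κ ∧
      x ∈ Set.range (F.map (TypeCat.ofHom (Subtype.val : S → X))) := by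
  have := F.preservesColimitsOfShape_of_isCardinalAccessible κ (HasCardinalLT.Set X κ)
  obtain ⟨⟨S, hS⟩, y, hy⟩ := Types.jointly_surjective_of_isColimit
    (isColimitOfPreserves F
      (HasCardinalLT.Set.isColimitCocone X κ (Cardinal.IsRegular.aleph0_le Fact.out))) x
  exact ⟨S, ((hasCardinalLT_iff_cardinal_mk_lt _ _).1 hS).le, y, hy⟩

lemma range_map_val_mono {X : Type u} {S T : Set X} (h : S ⊆ T) :
    Set.range (F.map (TypeCat.ofHom (Subtype.val : S → X))) ⊆
      Set.range (F.map (TypeCat.ofHom (Subtype.val : T → X))) := by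
  rintro _ ⟨y, rfl⟩
  refine ⟨F.map (TypeCat.ofHom (Set.inclusion h)) y, ?_⟩
  exact (ConcreteCategory.congr_hom (F.map_comp (TypeCat.ofHom (Set.inclusion h))
    (TypeCat.ofHom (Subtype.val : T → X))) y).symm

namespace Subcoalgebra

/-- A subset over which the structure map restricts is a subcoalgebra. -/
def ofMem {X : Coalgebra F} (S : Set X.V)
    (h : ∀ x ∈ S, X.str x ∈ Set.range (F.map (TypeCat.ofHom (Subtype.val : S → X.V)))) :
    Subcoalgebra X where
  carrier := S
  exists_str := by
    choose β hβ using h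
    refine ⟨TypeCat.ofHom fun x => β x.1 x.2, ?_⟩
    ext x
    exact hβ x.1 x.2

lemma str_mem {X : Coalgebra F} (U : Subcoalgebra X) {x : X.V} (hx : x ∈ U.carrier) :
    X.str x ∈ Set.range (F.map (TypeCat.ofHom (Subtype.val : U.carrier → X.V))) := by
  obtain ⟨β, hβ⟩ := U.exists_str
  exact ⟨β ⟨x, hx⟩, ConcreteCategory.congr_hom hβ ⟨x, hx⟩⟩

end Subcoalgebra

lemma mk_biUnion_le_of_le {A : Type u} {κ : Cardinal.{u}} (hκ : ℵ₀ ≤ κ) {S : Set A}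
    {T : A → Set A} (hS : #S ≤ κ) (hT : ∀ a, #(T a) ≤ κ) : #(⋃ a ∈ S, T a : Set A) ≤ κ :=
  calc #(⋃ a ∈ S, T a : Set A) ≤ #S * ⨆ a : S, #(T a.1) := mk_biUnion_le T S
    _ ≤ κ * κ := mul_le_mul' hS (ciSup_le' fun a => hT a)
    _ = κ := mul_eq_self hκ

/-- Starting from `{a}`, the operation `T` is iterated countably often; the union of the stages is
closed and has cardinality at most `ℵ₀ * κ = κ`. -/
lemma exists_closed_set {A : Type u} {κ : Cardinal.{u}} (hκ : ℵ₀ ≤ κ) {T : A → Set A}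
    (hT : ∀ a, #(T a) ≤ κ) (a : A) :
    ∃ S : Set A, a ∈ S ∧ #S ≤ κ ∧ ∀ s ∈ S, T s ⊆ S := by
  let S : ℕ → Set A := Nat.rec {a} fun _ S => ⋃ s ∈ S, T s
  have hS (n : ℕ) : #(S n).Elem ≤ κ := by
    induction n with
    | zero => exact (mk_singleton a).trans_le (one_lt_aleph0.le.trans hκ)
    | succ n ih => exact mk_biUnion_le_of_le hκ ih hT
  refine ⟨⋃ n, S n, Set.mem_iUnion.2 ⟨0, rfl⟩, ?_, fun s hs => ?_⟩
  · have h₁ := mk_iUnion_le_lift S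
    rw [lift_id'.{0, u}, mk_nat, lift_aleph0] at h₁
    refine h₁.trans ?_
    calc ℵ₀ * ⨆ n, lift.{0} #(S n).Elem ≤ κ * κ :=
          mul_le_mul' hκ (ciSup_le' fun n => by simpa using hS n)
      _ = κ := mul_eq_self hκ
  · obtain ⟨n, hn⟩ := Set.mem_iUnion.1 hs
    exact (Set.subset_biUnion_of_mem (u := T) hn).trans (Set.subset_iUnion S (n + 1))

theorem isBounded_of_isAccessible (h : Functor.IsAccessible.{u} F) : IsBounded F := by
  obtain ⟨κ, hκ, _⟩ := h.exists_cardinal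
  refine ⟨κ, fun A a => ?_⟩
  -- A set containing a support `T x` of the structure at each of its elements `x` is a
  -- subcoalgebra.
  choose T hT hTmem using fun a : A.V => exists_small_support κ (A.str a)
  obtain ⟨S, haS, hS, hTS⟩ := exists_closed_set hκ.out.aleph0_le hT a
  exact ⟨Subcoalgebra.ofMem S fun x hx => range_map_val_mono (hTS x hx) (hTmem x), haS, hS⟩

end Boundedness

/-! ### Consequences of weak preservation of pullbacks -/

section WeakPullbacks

variable {F : Type u ⥤ Type u}

namespace WeaklyPreservesPullbacks

variable (hpb : WeaklyPreservesPullbacks F)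
include hpb

/-- Elements are maps from a point, so the weak universal property is applied to a cone with apex
`PUnit`. -/
lemma exists_map_eq {P X Y Z : Type u} {p : P ⟶ X} {q : P ⟶ Y} {f : X ⟶ Z} {g : Y ⟶ Z}
    (sq : IsPullback p q f g) {x : F.obj X} {y : F.obj Y} (h : F.map f x = F.map g y) :
    ∃ w, F.map p w = x ∧ F.map q w = y := by
  obtain ⟨hw⟩ := hpb sq
  let a : PUnit ⟶ F.obj X := TypeCat.ofHom fun _ => x
  let b : PUnit ⟶ F.obj Y := TypeCat.ofHom fun _ => y
  have hab : a ≫ F.map f = b ≫ F.map g := by ext; exact h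
  exact ⟨hw.lift (PullbackCone.mk a b hab) PUnit.unit,
    ConcreteCategory.congr_hom (hw.fac (PullbackCone.mk a b hab) .left) PUnit.unit,
    ConcreteCategory.congr_hom (hw.fac (PullbackCone.mk a b hab) .right) PUnit.unit⟩

/-- The kernel pair of an injection is trivial, so two elements identified by `F.map f` have a
common preimage under the identity. -/
lemma map_injective {X Y : Type u} {f : X ⟶ Y} (hf : Function.Injective f) :
    Function.Injective (F.map f) := by
  intro x y h
  have := (mono_iff_injective f).2 hf
  obtain ⟨w, h₁, h₂⟩ := hpb.exists_map_eq (IsKernelPair.id_of_mono f) h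
  exact h₁.symm.trans h₂

/-- The pullback of the underlying sets of two homomorphisms carries a coalgebra structure. -/
lemma exists_coalgebra {A B D : Coalgebra F} (f : A ⟶ D) (g : B ⟶ D) :
    ∃ (P : Coalgebra F) (p : P ⟶ A) (q : P ⟶ B), p ≫ f = q ≫ g ∧
      ∀ a b, f.f a = g.f b → ∃ x, p.f x = a ∧ q.f x = b := by
  have sq := IsPullback.of_hasPullback f.f g.f
  have h (x : (pullback f.f g.f : Type u)) : F.map f.f (A.str (pullback.fst f.f g.f x)) =
      F.map g.f (B.str (pullback.snd f.f g.f x)) := by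
    rw [hom_str, hom_str]
    exact congrArg D.str (ConcreteCategory.congr_hom sq.w x)
  -- The structure is a choice of lifts: the image square is only a weak pullback, so it need not be
  -- unique.
  choose β hβ₁ hβ₂ using fun x => hpb.exists_map_eq sq (h x)
  refine ⟨⟨pullback f.f g.f, TypeCat.ofHom β⟩, ⟨pullback.fst f.f g.f, ?_⟩,
    ⟨pullback.snd f.f g.f, ?_⟩, ?_, fun a b hab => Types.exists_of_isPullback sq a b hab⟩
  · ext x; exact hβ₁ x
  · ext x; exact hβ₂ x
  · ext1; exact sq.w

/-- The set-theoretic kernel pair of `m` carries a coalgebra structure, so its two projections are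
homomorphisms and `m` cancels. -/
lemma injective_of_mono {A B : Coalgebra F} (m : A ⟶ B) [Mono m] : Function.Injective m.f := by
  intro a b hab
  obtain ⟨P, p, q, w, h⟩ := hpb.exists_coalgebra m m
  obtain ⟨x, rfl, rfl⟩ := h a b hab
  rw [(cancel_mono m).1 w]

/-- Two elements of coalgebras that are identified in `D` come from an element of the pullback. -/
lemma exists_of_isPullback {P A B D : Coalgebra F} {p : P ⟶ A} {q : P ⟶ B} {f : A ⟶ D}
    {g : B ⟶ D} (sq : IsPullback p q f g) {a : A.V} {b : B.V} (h : f.f a = g.f b) :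
    ∃ x, p.f x = a ∧ q.f x = b := by
  obtain ⟨Q, p', q', w, hQ⟩ := hpb.exists_coalgebra f g
  obtain ⟨x, rfl, rfl⟩ := hQ a b h
  -- The coalgebra on the set-theoretic pullback maps to the categorical one. The latter may have
  -- several elements over the same pair, so only existence is obtained.
  refine ⟨(sq.lift p' q' w).f x, ?_, ?_⟩
  · rw [← comp_apply, sq.lift_fst]
  · rw [← comp_apply, sq.lift_snd]

/-- A homomorphism whose image is contained in the image of a monomorphism factors through it. -/
lemma exists_lift {A B D : Coalgebra F} (f : A ⟶ D) (m : B ⟶ D) [Mono m]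
    (h : Set.range f.f ⊆ Set.range m.f) : ∃ g : A ⟶ B, g ≫ m = f := by
  choose s hs using fun a => h (Set.mem_range_self a)
  have hs' : TypeCat.ofHom s ≫ m.f = f.f := by ext a; exact hs a
  refine ⟨⟨TypeCat.ofHom s, ?_⟩, by ext1; exact hs'⟩
  ext a
  -- Compatibility with the structure maps may be tested after applying the injection `F.map m.f`.
  apply hpb.map_injective (hpb.injective_of_mono m)
  change F.map m.f (F.map (TypeCat.ofHom s) (A.str a)) = F.map m.f (B.str (s a))
  rw [hom_str, hs, ← hom_str, ← hs', F.map_comp]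
  rfl

end WeaklyPreservesPullbacks

namespace Subcoalgebra

variable {X : Coalgebra F}

/-- The union of two subcoalgebras. -/
def union (U V : Subcoalgebra X) : Subcoalgebra X :=
  ofMem (U.carrier ∪ V.carrier) fun _ hx =>
    hx.elim (fun h => range_map_val_mono Set.subset_union_left (U.str_mem h))
      (fun h => range_map_val_mono Set.subset_union_right (V.str_mem h))

/-- The intersection is the image in `X` of the pullback of the two inclusions. -/
lemma exists_inter (hpb : WeaklyPreservesPullbacks F) (U V : Subcoalgebra X) :
    ∃ W : Subcoalgebra X, W.carrier = U.carrier ∩ V.carrier := by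
  obtain ⟨P, p, q, w, h⟩ := hpb.exists_coalgebra U.incl V.incl
  refine ⟨image (p ≫ U.incl), Set.ext fun x => ⟨?_, ?_⟩⟩
  · rintro ⟨y, rfl⟩
    refine ⟨(p.f y).2, ?_⟩
    rw [w]
    exact (q.f y).2
  · rintro ⟨hU, hV⟩
    obtain ⟨y, hy, -⟩ := h ⟨x, hU⟩ ⟨x, hV⟩ rfl
    exact ⟨y, congrArg Subtype.val hy⟩

lemma range_incl (U : Subcoalgebra X) : Set.range U.incl.f = U.carrier :=
  Subtype.range_coe

/-- The lattice of subcoalgebras. -/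
noncomputable abbrev lattice (hpb : WeaklyPreservesPullbacks F) (X : Coalgebra F) :
    Lattice (Subcoalgebra X) where
  sup := union
  inf U V := (exists_inter hpb U V).choose
  le_sup_left _ _ := Set.subset_union_left
  le_sup_right _ _ := Set.subset_union_right
  sup_le _ _ _ := Set.union_subset
  inf_le_left U V := (exists_inter hpb U V).choose_spec.trans_subset Set.inter_subset_left
  inf_le_right U V := (exists_inter hpb U V).choose_spec.trans_subset Set.inter_subset_right
  le_inf _ U V h₁ h₂ := (Set.subset_inter h₁ h₂).trans_eq (exists_inter hpb U V).choose_spec.symm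

end Subcoalgebra

end WeakPullbacks

/-! ### Partial maps in a category with finite limits form a P-category -/

section ParIsPCategory

variable {C : Type u} [Category.{v} C] [HasFiniteLimits C]

attribute [local simp] prod.lift_fst prod.lift_snd prod.lift_fst_assoc prod.lift_snd_assoc

lemma isPullback_prodMap {P X Y Z P' X' Y' Z' : C} {p : P ⟶ X} {q : P ⟶ Y} {f : X ⟶ Z} {g : Y ⟶ Z}
    {p' : P' ⟶ X'} {q' : P' ⟶ Y'} {f' : X' ⟶ Z'} {g' : Y' ⟶ Z'}
    (sq : IsPullback p q f g) (sq' : IsPullback p' q' f' g') :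
    IsPullback (prod.map p p') (prod.map q q') (prod.map f f') (prod.map g g') :=
  ⟨⟨by rw [prod.map_map, prod.map_map, sq.w, sq'.w]⟩,
    ⟨PullbackCone.IsLimit.mk _
      (fun s => prod.lift
        (sq.lift (s.fst ≫ prod.fst) (s.snd ≫ prod.fst) (by
          simpa using s.condition =≫ prod.fst))
        (sq'.lift (s.fst ≫ prod.snd) (s.snd ≫ prod.snd) (by
          simpa using s.condition =≫ prod.snd)))
      (fun s => by ext <;> simp)
      (fun s => by ext <;> simp)
      (fun s m h₁ h₂ => by
        ext
        · apply sq.hom_ext <;> simp [← h₁, ← h₂]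
        · apply sq'.hom_ext <;> simp [← h₁, ← h₂])⟩⟩

/-- This square computes the composite of the diagonal with `f ⊠ f`, and so gives naturality of `Δ`;
that `m` is monic is essential. -/
lemma isPullback_diag {U X : C} (m : U ⟶ X) [Mono m] :
    IsPullback m (Limits.diag U) (Limits.diag X) (prod.map m m) :=
  ⟨⟨by simp⟩,
    ⟨PullbackCone.IsLimit.mk _
      (fun s => s.snd ≫ prod.fst)
      (fun s => by simpa using (s.condition =≫ prod.fst).symm)
      (fun s => by
        have h₁ := s.condition =≫ prod.fst
        have h₂ := s.condition =≫ prod.snd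
        simp only [Category.assoc, prod.lift_fst, prod.lift_snd, prod.map_fst, prod.map_snd,
          Category.comp_id] at h₁ h₂
        ext
        · simp
        · rw [← cancel_mono m]
          simp [← h₁, ← h₂])
      (fun s t _ h₂ => by simp [← h₂])⟩⟩

lemma isPullback_prod_fst {X Y : C} (Z : C) (f : X ⟶ Y) :
    IsPullback (prod.map f (𝟙 Z)) prod.fst prod.fst f :=
  ⟨⟨by simp⟩,
    ⟨PullbackCone.IsLimit.mk _
      (fun s => prod.lift s.snd (s.fst ≫ prod.snd))
      (fun s => by ext <;> simp [s.condition])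
      (fun s => by simp)
      (fun s t h₁ h₂ => by ext <;> simp [← h₁, ← h₂])⟩⟩

lemma isPullback_prod_snd {X Y : C} (Z : C) (f : X ⟶ Y) :
    IsPullback (prod.map (𝟙 Z) f) prod.snd prod.snd f :=
  ⟨⟨by simp⟩,
    ⟨PullbackCone.IsLimit.mk _
      (fun s => prod.lift (s.fst ≫ prod.fst) s.snd)
      (fun s => by ext <;> simp [s.condition])
      (fun s => by simp)
      (fun s t h₁ h₂ => by ext <;> simp [← h₁, ← h₂])⟩⟩

namespace Par

/-- The partial morphism `{m, φ}` between objects of `C`. -/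
abbrev partialHom {A B U : C} (m : U ⟶ A) [Mono m] (φ : U ⟶ B) : (⟨A⟩ : Par C) ⟶ ⟨B⟩ :=
  homMk (X := ⟨A⟩) (Y := ⟨B⟩) m φ

/-- The total morphism `{1, f}` between objects of `C`. -/
abbrev totalHom {A B : C} (f : A ⟶ B) : (⟨A⟩ : Par C) ⟶ ⟨B⟩ :=
  total (X := ⟨A⟩) (Y := ⟨B⟩) f

/-- The product of partial morphisms. -/
noncomputable abbrev prodHom {A A' B B' : C} (f : (⟨A⟩ : Par C) ⟶ ⟨A'⟩) (g : (⟨B⟩ : Par C) ⟶ ⟨B'⟩) :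
    (⟨A ⨯ B⟩ : Par C) ⟶ ⟨A' ⨯ B'⟩ :=
  (nearProduct C).map f g

lemma hom_cases {A B : C} {motive : ((⟨A⟩ : Par C) ⟶ ⟨B⟩) → Prop}
    (h : ∀ {U : C} (m : U ⟶ A) [Mono m] (φ : U ⟶ B), motive (partialHom m φ))
    (f : (⟨A⟩ : Par C) ⟶ ⟨B⟩) : motive f :=
  Quotient.ind (fun p => h p.incl p.map) f

lemma partialHom_congr {A B U : C} {m m' : U ⟶ A} [Mono m] [Mono m'] {φ φ' : U ⟶ B}
    (hm : m = m') (hφ : φ = φ') : partialHom m φ = partialHom m' φ' := by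
  subst hm hφ; rfl

/-- Frees composition from the chosen pullback: any pullback square computes it. -/
lemma partialHom_comp {A B D U V W : C} (m : U ⟶ A) [Mono m] (φ : U ⟶ B)
    (n : V ⟶ B) [Mono n] (ψ : V ⟶ D) {p : W ⟶ U} {q : W ⟶ V} (sq : IsPullback p q φ n)
    [Mono (p ≫ m)] : partialHom m φ ≫ partialHom n ψ = partialHom (p ≫ m) (q ≫ ψ) :=
  Quotient.sound ⟨(sq.isoPullback).symm, by simp, by simp⟩

lemma partialHom_comp_totalHom {A B D U : C} (m : U ⟶ A) [Mono m] (φ : U ⟶ B) (h : B ⟶ D) :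
    partialHom m φ ≫ totalHom h = partialHom m (φ ≫ h) := by
  have sq : IsPullback (𝟙 U) φ φ (𝟙 B) := IsPullback.of_horiz_isIso ⟨by simp⟩
  exact (partialHom_comp m φ (𝟙 B) h sq).trans (partialHom_congr (Category.id_comp m) rfl)

lemma totalHom_comp_partialHom {A B D V W : C} (f : A ⟶ B) (n : V ⟶ B) [Mono n]
    (ψ : V ⟶ D) {p : W ⟶ A} {q : W ⟶ V} (sq : IsPullback p q f n) [Mono p] :
    totalHom f ≫ partialHom n ψ = partialHom p (q ≫ ψ) :=
  (partialHom_comp (𝟙 A) f n ψ sq).trans (partialHom_congr (Category.comp_id p) rfl)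

lemma totalHom_id (A : C) : totalHom (𝟙 A) = 𝟙 (⟨A⟩ : Par C) := rfl

lemma totalHom_comp {A B D : C} (f : A ⟶ B) (g : B ⟶ D) :
    totalHom f ≫ totalHom g = totalHom (f ≫ g) :=
  partialHom_comp_totalHom _ _ _

lemma isIso_totalHom {A B : C} (f : A ⟶ B) [IsIso f] : IsIso (totalHom f) :=
  ⟨totalHom (inv f), by rw [totalHom_comp, IsIso.hom_inv_id, totalHom_id],
    by rw [totalHom_comp, IsIso.inv_hom_id, totalHom_id]⟩

lemma prodHom_partialHom {A A' B B' U V : C} (m : U ⟶ A) [Mono m] (φ : U ⟶ A')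
    (n : V ⟶ B) [Mono n] (ψ : V ⟶ B') :
    prodHom (partialHom m φ) (partialHom n ψ) = partialHom (prod.map m n) (prod.map φ ψ) := rfl

lemma prodHom_totalHom {A A' B B' : C} (f : A ⟶ A') (g : B ⟶ B') :
    prodHom (totalHom f) (totalHom g) = totalHom (prod.map f g) :=
  partialHom_congr prod.map_id_id rfl

lemma pair_totalHom {A B D : C} (f : A ⟶ B) (g : A ⟶ D) :
    ((nearProduct C).pair (totalHom f) (totalHom g) : (⟨A⟩ : Par C) ⟶ ⟨B ⨯ D⟩) =
      totalHom (prod.lift f g) := by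
  refine (congrArg (totalHom (Limits.diag A) ≫ ·) (prodHom_totalHom f g)).trans ?_
  exact (totalHom_comp _ _).trans (congrArg totalHom (by simp))

/-- The associativity morphism of `Par C`. -/
noncomputable abbrev assHom (A B D : C) : (⟨(A ⨯ B) ⨯ D⟩ : Par C) ⟶ ⟨A ⨯ B ⨯ D⟩ :=
  (nearProduct C).ass ⟨A⟩ ⟨B⟩ ⟨D⟩

/-- The transposition of `Par C`. -/
noncomputable abbrev trHom (A B : C) : (⟨A ⨯ B⟩ : Par C) ⟶ ⟨B ⨯ A⟩ :=
  (nearProduct C).tr ⟨A⟩ ⟨B⟩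

lemma assHom_eq (A B D : C) : assHom A B D = totalHom (prod.associator A B D).hom := by
  have h₁ : totalHom (prod.fst : (A ⨯ B) ⨯ D ⟶ A ⨯ B) ≫ totalHom prod.fst =
    totalHom (prod.fst ≫ prod.fst) := totalHom_comp _ _
  have h₂ : totalHom (prod.fst : (A ⨯ B) ⨯ D ⟶ A ⨯ B) ≫ totalHom prod.snd =
    totalHom (prod.fst ≫ prod.snd) := totalHom_comp _ _
  exact (congrArg₂ (nearProduct C).pair h₁
    ((congrArg ((nearProduct C).pair · _) h₂).trans (pair_totalHom _ _))).trans (pair_totalHom _ _)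

lemma trHom_eq (A B : C) : trHom A B = totalHom (prod.braiding A B).hom :=
  pair_totalHom _ _

/-- Total morphisms contain the projections and are closed under composition and `⊠`, so naturality
of the projections need only be checked against total morphisms. -/
lemma exists_eq_total_of_proj {X Y : Par C} {f : X ⟶ Y} (hf : (nearProduct C).Proj f) :
    ∃ g : X.of ⟶ Y.of, f = totalHom g := by
  induction hf with
  | id X => exact ⟨𝟙 _, rfl⟩
  | comp f g _ _ hf hg =>
    obtain ⟨f, rfl⟩ := hf
    obtain ⟨g, rfl⟩ := hg
    exact ⟨_, totalHom_comp _ _⟩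
  | map f g _ _ hf hg =>
    obtain ⟨f, rfl⟩ := hf
    obtain ⟨g, rfl⟩ := hg
    exact ⟨_, prodHom_totalHom _ _⟩
  | fst X Y => exact ⟨_, rfl⟩
  | snd X Y => exact ⟨_, rfl⟩

/-- The graph of `m` is the pullback needed to compute `⟨1, {m, φ}⟩`. -/
lemma isPullback_lift_id {U A : C} (m : U ⟶ A) [Mono m] :
    IsPullback m (prod.lift m (𝟙 U)) (Limits.diag A) (prod.map (𝟙 A) m) :=
  ⟨⟨by ext <;> simp⟩,
    ⟨PullbackCone.IsLimit.mk _
      (fun s => s.snd ≫ prod.snd)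
      (fun s => by simpa using (s.condition =≫ prod.snd).symm)
      (fun s => by
        have h₁ := s.condition =≫ prod.fst
        have h₂ := s.condition =≫ prod.snd
        simp only [Category.assoc, prod.lift_fst, prod.lift_snd, prod.map_fst, prod.map_snd,
          Category.comp_id] at h₁ h₂
        ext
        · simp [← h₁, h₂]
        · simp)
      (fun s t _ h₂ => by simp [← h₂])⟩⟩

lemma domain_partialHom {A B U : C} (m : U ⟶ A) [Mono m] (φ : U ⟶ B) :
    (nearProduct C).domain (partialHom m φ) = partialHom m m := by
  have h : totalHom (Limits.diag A) ≫ prodHom (𝟙 _) (partialHom m φ) =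
      partialHom m (prod.lift m (𝟙 U) ≫ prod.map (𝟙 A) φ) :=
    totalHom_comp_partialHom _ (prod.map (𝟙 A) m) (prod.map (𝟙 A) φ) (isPullback_lift_id m)
  exact (congrArg (· ≫ totalHom prod.fst) h).trans
    ((partialHom_comp_totalHom _ _ _).trans (partialHom_congr rfl (by simp)))

lemma isDomain_iff {A : C} {ε : (⟨A⟩ : Par C) ⟶ ⟨A⟩} : (nearProduct C).IsDomain ε ↔
    ∃ (U : C) (m : U ⟶ A) (_ : Mono m), ε = partialHom m m := by
  constructor
  · rintro ⟨⟨B⟩, φ, rfl⟩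
    induction φ using hom_cases with
    | h m φ => exact ⟨_, m, inferInstance, domain_partialHom m φ⟩
  · rintro ⟨U, m, _, rfl⟩
    exact ⟨⟨A⟩, partialHom m m, (domain_partialHom m m).symm⟩

lemma prodHom_id (A B : C) : prodHom (𝟙 (⟨A⟩ : Par C)) (𝟙 (⟨B⟩ : Par C)) = 𝟙 _ :=
  (prodHom_totalHom _ _).trans (congrArg totalHom prod.map_id_id)

lemma prodHom_comp {A A' A'' B B' B'' : C} (f : (⟨A⟩ : Par C) ⟶ ⟨A'⟩) (f' : (⟨A'⟩ : Par C) ⟶ ⟨A''⟩)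
    (g : (⟨B⟩ : Par C) ⟶ ⟨B'⟩) (g' : (⟨B'⟩ : Par C) ⟶ ⟨B''⟩) :
    prodHom (f ≫ f') (g ≫ g') = prodHom f g ≫ prodHom f' g' := by
  induction f using hom_cases with | h m φ
  induction f' using hom_cases with | h m' φ'
  induction g using hom_cases with | h n ψ
  induction g' using hom_cases with | h n' ψ'
  have sq := IsPullback.of_hasPullback φ m'
  have sq' := IsPullback.of_hasPullback ψ n'
  rw [partialHom_comp _ _ _ _ sq, partialHom_comp _ _ _ _ sq', prodHom_partialHom,
    prodHom_partialHom, prodHom_partialHom,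
    partialHom_comp _ _ _ _ (isPullback_prodMap sq sq')]
  exact partialHom_congr (prod.map_map _ _ _ _).symm (prod.map_map _ _ _ _).symm

lemma comp_diag {A B : C} (f : (⟨A⟩ : Par C) ⟶ ⟨B⟩) :
    f ≫ totalHom (Limits.diag B) = totalHom (Limits.diag A) ≫ prodHom f f := by
  induction f using hom_cases with | h m φ
  rw [prodHom_partialHom, partialHom_comp_totalHom,
    totalHom_comp_partialHom _ _ _ (isPullback_diag m)]
  exact partialHom_congr rfl (by simp)

lemma prodHom_comp_fst {A A' B B' : C} (f : (⟨A⟩ : Par C) ⟶ ⟨A'⟩) (g : B ⟶ B') :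
    prodHom f (totalHom g) ≫ totalHom prod.fst = totalHom prod.fst ≫ f := by
  induction f using hom_cases with | h m φ
  rw [totalHom_comp_partialHom _ _ _ (isPullback_prod_fst B m)]
  exact (partialHom_comp_totalHom _ _ _).trans (partialHom_congr rfl (prod.map_fst _ _))

lemma prodHom_comp_snd {A A' B B' : C} (f : A ⟶ A') (g : (⟨B⟩ : Par C) ⟶ ⟨B'⟩) :
    prodHom (totalHom f) g ≫ totalHom prod.snd = totalHom prod.snd ≫ g := by
  induction g using hom_cases with | h m φ
  rw [totalHom_comp_partialHom _ _ _ (isPullback_prod_snd A m)]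
  exact (partialHom_comp_totalHom _ _ _).trans (partialHom_congr rfl (prod.map_snd _ _))

lemma assHom_natural {A A' B B' D D' : C} (f : (⟨A⟩ : Par C) ⟶ ⟨A'⟩) (g : (⟨B⟩ : Par C) ⟶ ⟨B'⟩)
    (h : (⟨D⟩ : Par C) ⟶ ⟨D'⟩) :
    prodHom (prodHom f g) h ≫ assHom A' B' D' = assHom A B D ≫ prodHom f (prodHom g h) := by
  induction f using hom_cases with | h m φ
  induction g using hom_cases with | h n ψ
  induction h using hom_cases with | h k χ
  -- A commutative square with two parallel isomorphisms is a pullback.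
  have sq : IsPullback (prod.map (prod.map m n) k) (Limits.prod.associator _ _ _).hom
    (Limits.prod.associator _ _ _).hom (prod.map m (prod.map n k)) :=
      IsPullback.of_vert_isIso ⟨prod.associator_naturality m n k⟩
  rw [assHom_eq, assHom_eq]
  simp only [prodHom_partialHom]
  rw [partialHom_comp_totalHom, totalHom_comp_partialHom _ _ _ sq]
  exact partialHom_congr rfl (prod.associator_naturality φ ψ χ)

lemma trHom_natural {A A' B B' : C} (f : (⟨A⟩ : Par C) ⟶ ⟨A'⟩) (g : (⟨B⟩ : Par C) ⟶ ⟨B'⟩) :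
    prodHom f g ≫ trHom A' B' = trHom A B ≫ prodHom g f := by
  induction f using hom_cases with | h m φ
  induction g using hom_cases with | h n ψ
  have sq : IsPullback (prod.map m n) (prod.braiding _ _).hom (prod.braiding _ _).hom
    (prod.map n m) := IsPullback.of_vert_isIso ⟨braid_natural m n⟩
  rw [trHom_eq, trHom_eq]
  simp only [prodHom_partialHom]
  rw [partialHom_comp_totalHom, totalHom_comp_partialHom _ _ _ sq]
  exact partialHom_congr rfl (braid_natural φ ψ)

lemma assHom_pentagon (A B D E : C) :
    prodHom (assHom A B D) (𝟙 _) ≫ assHom A (B ⨯ D) E ≫ prodHom (𝟙 _) (assHom B D E) =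
      assHom (A ⨯ B) D E ≫ assHom A B (D ⨯ E) := by
  simp only [assHom_eq, ← totalHom_id, prodHom_totalHom, totalHom_comp]
  exact congrArg totalHom (prod.pentagon A B D E)

lemma assHom_hexagon (A B D : C) :
    assHom A B D ≫ trHom A (B ⨯ D) ≫ assHom B D A =
      prodHom (trHom A B) (𝟙 _) ≫ assHom B A D ≫ prodHom (𝟙 _) (trHom A D) := by
  simp only [assHom_eq, trHom_eq, ← totalHom_id, prodHom_totalHom, totalHom_comp]
  refine congrArg totalHom ?_
  ext <;> simp

lemma diag_comp_map_fst_snd (A B : C) :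
    Limits.diag (A ⨯ B) ≫ prod.map prod.fst prod.snd = 𝟙 (A ⨯ B) := by
  ext <;> simp

theorem isPCategory : (nearProduct C).IsPCategory where
  map_id X Y := prodHom_id X.of Y.of
  map_comp := prodHom_comp
  diag_natural := comp_diag
  diag_fst X := (totalHom_comp _ _).trans (congrArg totalHom (prod.lift_fst _ _))
  diag_snd X := (totalHom_comp _ _).trans (congrArg totalHom (prod.lift_snd _ _))
  diag_map X Y := (congrArg (totalHom (Limits.diag (X.of ⨯ Y.of)) ≫ ·)
    (prodHom_totalHom prod.fst prod.snd)).trans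
      ((totalHom_comp _ _).trans (congrArg totalHom (diag_comp_map_fst_snd X.of Y.of)))
  fst_natural {X X' Y Y'} f g hg := by
    obtain ⟨g, rfl⟩ := exists_eq_total_of_proj hg
    exact prodHom_comp_fst f g
  snd_natural {X X' Y Y'} f g hf := by
    obtain ⟨f, rfl⟩ := exists_eq_total_of_proj hf
    exact prodHom_comp_snd f g
  ass_natural := assHom_natural
  ass_isIso X Y Z := by
    have h : IsIso (assHom X.of Y.of Z.of) := by
      rw [assHom_eq]
      exact isIso_totalHom _
    exact h
  tr_natural := trHom_natural
  tr_tr X Y := (congrArg₂ (· ≫ ·) (trHom_eq X.of Y.of) (trHom_eq Y.of X.of)).trans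
    ((totalHom_comp _ _).trans (congrArg totalHom (prod.symmetry _ _)))
  pentagon W X Y Z := assHom_pentagon W.of X.of Y.of Z.of
  hexagon X Y Z := assHom_hexagon X.of Y.of Z.of

end Par

end ParIsPCategory

/-! ### Coproducts described by their universal property -/

section Coproducts

variable {D : Type u} [Category.{v} D] {ι : Type}

/-- The morphisms `k i` exhibit `c` as a coproduct of the objects `Y i`. -/
def IsCoproduct {Y : ι → D} {c : D} (k : ∀ i, Y i ⟶ c) : Prop :=
  ∀ ⦃W : D⦄ (φ : ∀ i, Y i ⟶ W), ∃! g : c ⟶ W, ∀ i, k i ≫ g = φ i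

namespace IsCoproduct

variable {Y : ι → D} {c c' : D} {k : ∀ i, Y i ⟶ c} {k' : ∀ i, Y i ⟶ c'}

lemma hom_ext (h : IsCoproduct k) {W : D} {g g' : c ⟶ W} (hg : ∀ i, k i ≫ g = k i ≫ g') : g = g' :=
  (h fun i => k i ≫ g').unique hg fun _ => rfl

lemma isIso (h : IsCoproduct k) (h' : IsCoproduct k') {t : c ⟶ c'} (ht : ∀ i, k i ≫ t = k' i) :
    IsIso t := by
  obtain ⟨s, hs, -⟩ := h' k
  refine ⟨s, h.hom_ext fun i => ?_, h'.hom_ext fun i => ?_⟩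
  · rw [← Category.assoc, ht, hs, Category.comp_id]
  · rw [← Category.assoc, hs, ht, Category.comp_id]

lemma comp_isIso (h : IsCoproduct k) (t : c ⟶ c') [IsIso t] : IsCoproduct fun i => k i ≫ t := by
  intro W φ
  obtain ⟨g, hg, hg'⟩ := h φ
  refine ⟨inv t ≫ g, fun i => by simp [hg], fun g₁ hg₁ => ?_⟩
  rw [← hg' (t ≫ g₁) fun i => by simpa using hg₁ i, IsIso.inv_hom_id_assoc]

lemma hasCoproduct (h : IsCoproduct k) : HasCoproduct Y := by
  choose g hg hg' using fun W φ => h (W := W) φ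
  exact ⟨⟨⟨Cofan.mk c k, Cofan.IsColimit.mk _ (fun s => g s.pt s.inj) (fun s i => hg s.pt s.inj i)
    (fun s m hm => hg' s.pt s.inj m hm)⟩⟩⟩

end IsCoproduct

lemma isCoproduct_sigmaι (Y : ι → D) [HasCoproduct Y] : IsCoproduct (Sigma.ι Y) := fun _ φ =>
  ⟨Sigma.desc φ, fun i => Sigma.ι_desc φ i, fun g hg => Sigma.hom_ext _ _ fun i => by simp [hg]⟩

/-- The family consisting of two given objects. -/
abbrev pairObj (A B : D) (j : WalkingPair) : D := WalkingPair.casesOn j A B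

/-- The family consisting of two given morphisms. -/
abbrev pairHom {A B E : D} (f : A ⟶ E) (g : B ⟶ E) : ∀ j, pairObj A B j ⟶ E
  | .left => f
  | .right => g

lemma isCoproduct_pairHom_inl_inr (A B : D) [HasBinaryCoproduct A B] :
    IsCoproduct (pairHom (coprod.inl : A ⟶ A ⨿ B) coprod.inr) := by
  intro W φ
  refine ⟨coprod.desc (φ .left) (φ .right), ?_, fun g hg => ?_⟩
  · rintro (_ | _)
    · exact coprod.inl_desc _ _
    · exact coprod.inr_desc _ _
  · apply coprod.hom_ext
    · exact (hg .left).trans (coprod.inl_desc _ _).symm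
    · exact (hg .right).trans (coprod.inr_desc _ _).symm

lemma IsCoproduct.isIso_coprodDesc {Y : WalkingPair → D} {c : D} {k : ∀ j, Y j ⟶ c}
    (h : IsCoproduct k) [HasBinaryCoproduct (Y .left) (Y .right)] :
    IsIso (coprod.desc (k .left) (k .right)) := by
  obtain ⟨s, hs, -⟩ := h fun j => match j with
    | .left => coprod.inl
    | .right => (coprod.inr : Y .right ⟶ Y .left ⨿ Y .right)
  have hl : k .left ≫ s = coprod.inl := hs .left
  have hr : k .right ≫ s = coprod.inr := hs .right
  refine ⟨s, ?_, h.hom_ext ?_⟩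
  · apply coprod.hom_ext <;> simp [hl, hr]
  · rintro (_ | _)
    · rw [← Category.assoc, hl, coprod.inl_desc, Category.comp_id]
    · rw [← Category.assoc, hr, coprod.inr_desc, Category.comp_id]

end Coproducts

/-! ### Graphs of partial morphisms of coalgebras -/

section Graph

variable {F : Type u ⥤ Type u} [HasFiniteLimits (Coalgebra F)]

/-- The graph of a partial morphism of coalgebras. -/
def graph {A B : Coalgebra F} (f : (⟨A⟩ : Pfn F) ⟶ ⟨B⟩) (x : A.V) (y : B.V) : Prop :=
  Quotient.lift (s := PartialMap.setoid A B) (fun p => ∃ u, p.incl.f u = x ∧ p.map.f u = y)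
    (by
      rintro p q ⟨θ, h₁, h₂⟩
      have h₁' : θ.inv ≫ p.incl = q.incl := by simp [← h₁]
      have h₂' : θ.inv ≫ p.map = q.map := by simp [← h₂]
      refine propext ⟨?_, ?_⟩
      · rintro ⟨u, hx, hy⟩
        rw [← h₁] at hx
        rw [← h₂] at hy
        exact ⟨θ.hom.f u, hx, hy⟩
      · rintro ⟨u, hx, hy⟩
        rw [← h₁'] at hx
        rw [← h₂'] at hy
        exact ⟨θ.inv.f u, hx, hy⟩) f

open Par

lemma graph_partialHom {A B U : Coalgebra F} (m : U ⟶ A) [Mono m] (φ : U ⟶ B) (x : A.V) (y : B.V) :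
    graph (partialHom m φ) x y ↔ ∃ u, m.f u = x ∧ φ.f u = y := Iff.rfl

lemma graph_totalHom {A B : Coalgebra F} (f : A ⟶ B) (x : A.V) (y : B.V) :
    graph (totalHom f) x y ↔ f.f x = y :=
  ⟨by rintro ⟨_, rfl, h⟩; exact h, fun h => ⟨x, rfl, h⟩⟩

lemma graph_domain {A B : Coalgebra F} (f : (⟨A⟩ : Pfn F) ⟶ ⟨B⟩) (x y : A.V) :
    graph ((nearProduct (Coalgebra F)).domain f) x y ↔
      x ∈ (domSubcoalgebra f).carrier ∧ x = y := by
  induction f using hom_cases with | h m φ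
  rw [domain_partialHom]
  exact ⟨fun ⟨u, hx, hy⟩ => ⟨⟨u, hx⟩, hx.symm.trans hy⟩, fun ⟨⟨u, hx⟩, hy⟩ => ⟨u, hx, hx.trans hy⟩⟩

lemma graph_of_isDomain {A : Coalgebra F} {ε : (⟨A⟩ : Pfn F) ⟶ ⟨A⟩}
    (hε : (nearProduct (Coalgebra F)).IsDomain ε) (x y : A.V) :
    graph ε x y ↔ x ∈ (domSubcoalgebra ε).carrier ∧ x = y := by
  obtain ⟨U, m, _, rfl⟩ := isDomain_iff.1 hε
  rw [← graph_domain, domain_partialHom]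

namespace WeaklyPreservesPullbacks

variable (hpb : WeaklyPreservesPullbacks F)
include hpb

lemma graph_unique {A B : Coalgebra F} {f : (⟨A⟩ : Pfn F) ⟶ ⟨B⟩} {x : A.V} {y y' : B.V}
    (h : graph f x y) (h' : graph f x y') : y = y' := by
  induction f using hom_cases with | h m φ
  obtain ⟨u, rfl, rfl⟩ := h
  obtain ⟨u', hu, rfl⟩ := h'
  rw [hpb.injective_of_mono m hu]

lemma graph_comp {A B D : Coalgebra F} (f : (⟨A⟩ : Pfn F) ⟶ ⟨B⟩) (g : (⟨B⟩ : Pfn F) ⟶ ⟨D⟩)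
    (x : A.V) (z : D.V) : graph (f ≫ g) x z ↔ ∃ y, graph f x y ∧ graph g y z := by
  induction f using hom_cases with | h m φ
  induction g using hom_cases with | h n ψ
  have sq := IsPullback.of_hasPullback φ n
  rw [partialHom_comp m φ n ψ sq]
  simp only [graph_partialHom, comp_apply]
  constructor
  · rintro ⟨w, rfl, rfl⟩
    refine ⟨_, ⟨_, rfl, rfl⟩, ⟨_, ?_, rfl⟩⟩
    rw [← comp_apply, ← comp_apply, sq.w]
  · rintro ⟨_, ⟨u, rfl, rfl⟩, ⟨v, hv, rfl⟩⟩
    obtain ⟨w, rfl, rfl⟩ := hpb.exists_of_isPullback sq hv.symm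
    exact ⟨w, rfl, rfl⟩

lemma graph_totalHom_comp {A B D : Coalgebra F} (f : A ⟶ B) (g : (⟨B⟩ : Pfn F) ⟶ ⟨D⟩)
    (x : A.V) (z : D.V) : graph (totalHom f ≫ g) x z ↔ graph g (f.f x) z := by
  simp [hpb.graph_comp, graph_totalHom]

/-- Equal graphs force the two monomorphisms to have equal images, so each factors through the
other; the second legs then agree by injectivity. -/
lemma graph_ext {A B : Coalgebra F} {f g : (⟨A⟩ : Pfn F) ⟶ ⟨B⟩}
    (h : ∀ x y, graph f x y ↔ graph g x y) : f = g := by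
  induction f using hom_cases with | @h U m _ φ
  induction g using hom_cases with | @h V n _ φ'
  have hmn : Set.range m.f = Set.range n.f := by
    ext x
    constructor
    · rintro ⟨u, rfl⟩
      obtain ⟨v, hv, -⟩ := (h _ _).1 ⟨u, rfl, rfl⟩
      exact ⟨v, hv⟩
    · rintro ⟨v, rfl⟩
      obtain ⟨u, hu, -⟩ := (h _ _).2 ⟨v, rfl, rfl⟩
      exact ⟨u, hu⟩
  obtain ⟨a, ha⟩ := hpb.exists_lift m n hmn.le
  obtain ⟨b, hb⟩ := hpb.exists_lift n m hmn.ge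
  refine Quotient.sound (PartialMap.equivalent_of a b ha hb (hom_ext_apply fun u => ?_))
  obtain ⟨v, hv, hv'⟩ := (h _ _).1 ⟨u, rfl, rfl⟩
  have hav : n.f v = n.f (a.f u) := by
    rw [← comp_apply, ha]
    exact hv
  exact (congrArg φ'.f (hpb.injective_of_mono n hav)).symm.trans hv'

lemma graph_comp_of_isDomain {A B : Coalgebra F} {ε : (⟨A⟩ : Pfn F) ⟶ ⟨A⟩}
    (hε : (nearProduct (Coalgebra F)).IsDomain ε) (f : (⟨A⟩ : Pfn F) ⟶ ⟨B⟩) (x : A.V) (y : B.V) :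
    graph (ε ≫ f) x y ↔ x ∈ (domSubcoalgebra ε).carrier ∧ graph f x y := by
  simp [hpb.graph_comp, graph_of_isDomain hε, and_assoc]

lemma graph_comp_isDomain {A B : Coalgebra F} {ε : (⟨B⟩ : Pfn F) ⟶ ⟨B⟩}
    (hε : (nearProduct (Coalgebra F)).IsDomain ε) (f : (⟨A⟩ : Pfn F) ⟶ ⟨B⟩) (x : A.V) (y : B.V) :
    graph (f ≫ ε) x y ↔ graph f x y ∧ y ∈ (domSubcoalgebra ε).carrier := by
  simp [hpb.graph_comp, graph_of_isDomain hε, ← and_assoc]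

end WeaklyPreservesPullbacks

end Graph

/-! ### Disjoint unions as coproducts of partial morphisms, and distributivity -/

section CoalgebraCoproducts

variable {F : Type u ⥤ Type u} {ι : Type}

/-- The disjoint union of coalgebras. -/
def sigmaCoalgebra (Y : ι → Coalgebra F) : Coalgebra F where
  V := Σ i, (Y i).V
  str := TypeCat.ofHom fun p => F.map (TypeCat.ofHom (Sigma.mk p.1)) ((Y p.1).str p.2)

/-- The inclusion of a summand. -/
def sigmaIncl (Y : ι → Coalgebra F) (i : ι) : Y i ⟶ sigmaCoalgebra Y where
  f := TypeCat.ofHom fun y => (⟨i, y⟩ : Σ i, (Y i).V)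
  h := by ext; rfl

/-- The homomorphism out of a disjoint union. -/
def sigmaDesc {Y : ι → Coalgebra F} {Z : Coalgebra F} (f : ∀ i, Y i ⟶ Z) :
    sigmaCoalgebra Y ⟶ Z where
  f := TypeCat.ofHom fun p => (f p.1).f p.2
  h := by
    ext ⟨i, y⟩
    refine Eq.trans ?_ (hom_str (f i) y)
    exact (ConcreteCategory.congr_hom (F.map_comp (TypeCat.ofHom (Sigma.mk i))
      (TypeCat.ofHom fun p : Σ i, (Y i).V => (f p.1).f p.2)) ((Y i).str y)).symm

lemma bijective_sigmaIncl (Y : ι → Coalgebra F) :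
    Function.Bijective fun p : Σ i, (Y i).V => (sigmaIncl Y p.1).f p.2 :=
  ⟨fun _ _ h => h, fun p => ⟨p, rfl⟩⟩

variable [HasFiniteLimits (Coalgebra F)]

namespace WeaklyPreservesPullbacks

open Par

variable (hpb : WeaklyPreservesPullbacks F)
include hpb

/-- A decomposition of the underlying set into disjoint images of monomorphisms is a coproduct
of partial morphisms. -/
lemma isCoproduct_totalHom {Y : ι → Coalgebra F} {Z : Coalgebra F} {a : ∀ i, Y i ⟶ Z}
    (ha : Function.Bijective fun p : Σ i, (Y i).V => (a p.1).f p.2) :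
    IsCoproduct (Y := fun i => (⟨Y i⟩ : Pfn F)) fun i => totalHom (a i) := by
  rintro ⟨W⟩ φ
  have hφ (i) : ∃ (U : Coalgebra F) (m : U ⟶ Y i) (_ : Mono m) (ψ : U ⟶ W),
      φ i = partialHom m ψ := by
    induction φ i using hom_cases with | h m ψ
    exact ⟨_, m, inferInstance, ψ, rfl⟩
  choose U m hm ψ hψ using hφ
  -- The induced partial morphism is defined on the disjoint union of the domains `U i`, which
  -- embeds in `Z` because the images of the `a i` are disjoint.
  have : Mono (sigmaDesc fun i => m i ≫ a i) := by
    refine mono_of_injective ?_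
    rintro ⟨i, u⟩ ⟨j, v⟩ h
    obtain ⟨rfl, h'⟩ := Sigma.mk.inj_iff.1 (ha.1 (a₁ := ⟨i, (m i).f u⟩) (a₂ := ⟨j, (m j).f v⟩) h)
    rw [hpb.injective_of_mono (m i) (eq_of_heq h')]
  refine ⟨partialHom (sigmaDesc fun i => m i ≫ a i) (sigmaDesc ψ), fun i => ?_, fun g hg => ?_⟩
  · refine hpb.graph_ext fun y w => ?_
    rw [hpb.graph_totalHom_comp, hψ]
    constructor
    · rintro ⟨⟨j, u⟩, h, h'⟩
      obtain ⟨rfl, h'⟩ := Sigma.mk.inj_iff.1 (ha.1 (a₁ := ⟨j, (m j).f u⟩) (a₂ := ⟨i, y⟩) h)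
      exact ⟨u, eq_of_heq h', by assumption⟩
    · rintro ⟨u, rfl, rfl⟩
      exact ⟨⟨i, u⟩, rfl, rfl⟩
  · refine hpb.graph_ext fun z w => ?_
    obtain ⟨⟨i, y⟩, rfl⟩ := ha.2 z
    dsimp only
    rw [← hpb.graph_totalHom_comp, hg, hψ]
    constructor
    · rintro ⟨u, rfl, rfl⟩
      exact ⟨⟨i, u⟩, rfl, rfl⟩
    · rintro ⟨⟨j, u⟩, h, h'⟩
      obtain ⟨rfl, h'⟩ := Sigma.mk.inj_iff.1 (ha.1 (a₁ := ⟨j, (m j).f u⟩) (a₂ := ⟨i, y⟩) h)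
      exact ⟨u, eq_of_heq h', by assumption⟩

/-- The second projection tells the summands apart. Every element of `A ⨯ Z` is hit because `A ⨯ Y
i` is the pullback of `a i` along `prod.snd`, and coalgebra pullbacks cover the set-theoretic ones.
-/
lemma bijective_prodMap {Y : ι → Coalgebra F} {Z : Coalgebra F} {a : ∀ i, Y i ⟶ Z}
    (ha : Function.Bijective fun p : Σ i, (Y i).V => (a p.1).f p.2) (A : Coalgebra F) :
    Function.Bijective fun p : Σ i, (A ⨯ Y i).V => (prod.map (𝟙 A) (a p.1)).f p.2 := by
  have hmono (i) : Mono (a i) := mono_of_injective fun y y' h =>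
    eq_of_heq (Sigma.mk.inj_iff.1 (ha.1 (a₁ := ⟨i, y⟩) (a₂ := ⟨i, y'⟩) h)).2
  have hsnd (i) (p : (A ⨯ Y i).V) : (prod.snd : A ⨯ Z ⟶ Z).f ((prod.map (𝟙 A) (a i)).f p) =
      (a i).f ((prod.snd : A ⨯ Y i ⟶ Y i).f p) := by
    rw [← comp_apply, ← comp_apply, prod.map_snd]
  constructor
  · rintro ⟨i, p⟩ ⟨j, q⟩ h
    have h' := (hsnd i p).symm.trans ((congrArg (prod.snd : A ⨯ Z ⟶ Z).f h).trans (hsnd j q))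
    obtain ⟨rfl, -⟩ := Sigma.mk.inj_iff.1 (ha.1 (a₁ := ⟨i, _⟩) (a₂ := ⟨j, _⟩) h')
    exact Sigma.ext rfl (heq_of_eq (hpb.injective_of_mono (prod.map (𝟙 A) (a i)) h))
  · intro q
    obtain ⟨⟨i, y⟩, hy⟩ := ha.2 ((prod.snd : A ⨯ Z ⟶ Z).f q)
    obtain ⟨p, hp, -⟩ := hpb.exists_of_isPullback (isPullback_prod_snd A (a i)) hy.symm
    exact ⟨⟨i, p⟩, hp⟩

/-- The legs `k i` of an arbitrary coproduct are not known to be total, so it is compared with the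
disjoint union by an isomorphism `θ`, which `⊠` preserves. -/
lemma isCoproduct_map {Y : ι → Pfn F} {c : Pfn F} {k : ∀ i, Y i ⟶ c} (hk : IsCoproduct k)
    (X : Pfn F) : IsCoproduct fun i => (nearProduct (Coalgebra F)).map (𝟙 X) (k i) := by
  have hσ := hpb.isCoproduct_totalHom (bijective_sigmaIncl fun i => (Y i).of)
  obtain ⟨θ, hθ, -⟩ := hσ k
  have : IsIso θ := hσ.isIso hk hθ
  have h := hpb.isCoproduct_totalHom
    (a := fun i => prod.map (𝟙 X.of) (sigmaIncl (fun i => (Y i).of) i))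
    (hpb.bijective_prodMap (bijective_sigmaIncl fun i => (Y i).of) X.of)
  have : IsIso (prodHom (𝟙 (⟨X.of⟩ : Pfn F)) θ) :=
    ⟨prodHom (𝟙 _) (inv θ), by rw [← prodHom_comp, IsIso.hom_inv_id, Category.comp_id, prodHom_id],
      by rw [← prodHom_comp, IsIso.inv_hom_id, Category.comp_id, prodHom_id]⟩
  have h' (i) : totalHom (prod.map (𝟙 X.of) (sigmaIncl (fun i => (Y i).of) i)) ≫
      prodHom (𝟙 (⟨X.of⟩ : Pfn F)) θ = prodHom (𝟙 (⟨X.of⟩ : Pfn F)) (k i) := by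
    rw [← prodHom_totalHom, ← prodHom_comp, ← hθ i]
    exact congrArg (prodHom · _) (Category.comp_id (𝟙 (⟨X.of⟩ : Pfn F)))
  exact (congrArg IsCoproduct (funext h')).mp (h.comp_isIso (prodHom (𝟙 (⟨X.of⟩ : Pfn F)) θ))

lemma hasCoproductsOfShape (ι : Type) : HasCoproductsOfShape ι (Pfn F) where
  has_colimit K := by
    have := (hpb.isCoproduct_totalHom
      (bijective_sigmaIncl fun i => (K.obj ⟨i⟩).of)).hasCoproduct
    exact hasColimit_of_iso (F := Discrete.functor fun i => K.obj ⟨i⟩) Discrete.natIsoFunctor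

theorem isPSigmaCategory : (nearProduct (Coalgebra F)).IsPSigmaCategory where
  toIsPCategory := isPCategory
  hasBinaryCoproducts := hpb.hasCoproductsOfShape WalkingPair
  hasCountableCoproducts := hpb.hasCoproductsOfShape ℕ
  dist_isIso X Y Z := by
    have := hpb.hasCoproductsOfShape WalkingPair
    exact (hpb.isCoproduct_map (isCoproduct_pairHom_inl_inr Y Z) X).isIso_coprodDesc
  distSigma_isIso X Y := by
    have := hpb.hasCoproductsOfShape ℕ
    exact (isCoproduct_sigmaι _).isIso (hpb.isCoproduct_map (isCoproduct_sigmaι Y) X)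
      fun i => Sigma.ι_desc _ i

end WeaklyPreservesPullbacks

end CoalgebraCoproducts

open Par

/-! ### Ranges -/

section Ranges

variable {F : Type u ⥤ Type u} [HasFiniteLimits (Coalgebra F)]

lemma domSubcoalgebra_partialHom_incl {A B : Coalgebra F} (U : Subcoalgebra A)
    (φ : U.toCoalgebra ⟶ B) : domSubcoalgebra (partialHom U.incl φ) = U :=
  Subcoalgebra.ext U.range_incl

lemma domSubcoalgebra_domain_incl {A : Coalgebra F} (U : Subcoalgebra A) :
    domSubcoalgebra ((nearProduct (Coalgebra F)).domain (partialHom U.incl U.incl)) = U := by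
  rw [domain_partialHom, domSubcoalgebra_partialHom_incl]

lemma isDomain_partialHom {A U : Coalgebra F} (m : U ⟶ A) [Mono m] :
    (nearProduct (Coalgebra F)).IsDomain (partialHom m m) :=
  isDomain_iff.2 ⟨U, m, inferInstance, rfl⟩

namespace WeaklyPreservesPullbacks

variable (hpb : WeaklyPreservesPullbacks F)
include hpb

lemma isDomain_ext {A : Coalgebra F} {ε δ : (⟨A⟩ : Pfn F) ⟶ ⟨A⟩}
    (hε : (nearProduct (Coalgebra F)).IsDomain ε) (hδ : (nearProduct (Coalgebra F)).IsDomain δ)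
    (h : domSubcoalgebra ε = domSubcoalgebra δ) : ε = δ :=
  hpb.graph_ext fun x y => by rw [graph_of_isDomain hε, graph_of_isDomain hδ, h]

lemma isDomain_comp_comm {A : Coalgebra F} {ε δ : (⟨A⟩ : Pfn F) ⟶ ⟨A⟩}
    (hε : (nearProduct (Coalgebra F)).IsDomain ε) (hδ : (nearProduct (Coalgebra F)).IsDomain δ) :
    ε ≫ δ = δ ≫ ε :=
  hpb.graph_ext fun x y => by
    rw [hpb.graph_comp_of_isDomain hε, hpb.graph_comp_of_isDomain hδ, graph_of_isDomain hε,
      graph_of_isDomain hδ]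
    exact and_left_comm

/-- If every `y` in the domain of `ε` is a value of `φ`, and graphs are single-valued, then the
behaviour of `ψ` at `y` can be read off from the composite of `φ` with `ψ`. -/
lemma isRange_of_forall {A B : Coalgebra F} {φ : (⟨A⟩ : Pfn F) ⟶ ⟨B⟩} {ε : (⟨B⟩ : Pfn F) ⟶ ⟨B⟩}
    (hε : (nearProduct (Coalgebra F)).IsDomain ε)
    (h : ∀ y, y ∈ (domSubcoalgebra ε).carrier ↔ ∃ x, graph φ x y) :
    (nearProduct (Coalgebra F)).IsRange φ ε where
  isDomain := hε
  comp_eq := hpb.graph_ext fun x y => by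
    rw [hpb.graph_comp_isDomain hε, h]
    exact and_iff_left_of_imp fun hxy => ⟨x, hxy⟩
  cancel {Z} ψ ψ' hψ := by
    have key (χ χ' : (⟨B⟩ : Pfn F) ⟶ Z) (hχ : φ ≫ χ = φ ≫ χ') (y : B.V) (z : Z.of.V)
        (hy : y ∈ (domSubcoalgebra ε).carrier) (hyz : graph χ y z) : graph χ' y z := by
      obtain ⟨x, hxy⟩ := (h y).1 hy
      have hxz := (hpb.graph_comp φ χ x z).2 ⟨y, hxy, hyz⟩
      rw [hχ] at hxz
      obtain ⟨y', hxy', hyz'⟩ := (hpb.graph_comp φ χ' x z).1 hxz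
      rwa [hpb.graph_unique hxy hxy']
    refine hpb.graph_ext fun y z => ?_
    rw [hpb.graph_comp_of_isDomain hε, hpb.graph_comp_of_isDomain hε]
    exact and_congr_right fun hy => ⟨key ψ ψ' hψ y z hy, key ψ' ψ hψ.symm y z hy⟩

/-- The image of a homomorphism is the range of each partial morphism it represents. -/
lemma isRange_partialHom {A B U V : Coalgebra F} (m : U ⟶ A) [Mono m] (φ : U ⟶ B) (n : V ⟶ B)
    [Mono n] (h : Set.range n.f = Set.range φ.f) :
    (nearProduct (Coalgebra F)).IsRange (partialHom m φ) (partialHom n n) := by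
  refine hpb.isRange_of_forall (isDomain_partialHom n) fun y => ?_
  change y ∈ Set.range n.f ↔ _
  rw [h]
  exact ⟨fun ⟨u, hu⟩ => ⟨_, u, rfl, hu⟩, fun ⟨_, u, _, hu⟩ => ⟨u, hu⟩⟩

lemma isRange_partialHom_image {A B U : Coalgebra F} (m : U ⟶ A) [Mono m] (φ : U ⟶ B) :
    (nearProduct (Coalgebra F)).IsRange (partialHom m φ)
      (partialHom (Subcoalgebra.image φ).incl (Subcoalgebra.image φ).incl) :=
  hpb.isRange_partialHom m φ _ (Subcoalgebra.image φ).range_incl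

/-- Each of two ranges absorbs the other, and domains commute. -/
lemma isRange_unique {A B : Coalgebra F} {φ : (⟨A⟩ : Pfn F) ⟶ ⟨B⟩} {ε δ : (⟨B⟩ : Pfn F) ⟶ ⟨B⟩}
    (hε : (nearProduct (Coalgebra F)).IsRange φ ε) (hδ : (nearProduct (Coalgebra F)).IsRange φ δ) :
    ε = δ := by
  have h₁ := hε.cancel δ (𝟙 _) (by rw [hδ.comp_eq, Category.comp_id])
  have h₂ := hδ.cancel ε (𝟙 _) (by rw [hε.comp_eq, Category.comp_id])
  rw [Category.comp_id] at h₁ h₂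
  rw [← h₁, hpb.isDomain_comp_comm hε.isDomain hδ.isDomain, h₂]

/-- The product map is `1 × e'` followed by `e × 1`. Each factor is a pullback of a surjection along
a projection, hence surjective, since coalgebra pullbacks cover set-theoretic ones. -/
lemma surjective_prodMap {A A' B B' : Coalgebra F} {e : A ⟶ B} {e' : A' ⟶ B'}
    (he : Function.Surjective e.f) (he' : Function.Surjective e'.f) :
    Function.Surjective (prod.map e e').f := by
  intro y
  obtain ⟨b, hb⟩ := he ((prod.fst : B ⨯ B' ⟶ B).f y)
  obtain ⟨x, rfl, -⟩ := hpb.exists_of_isPullback (isPullback_prod_fst B' e) hb.symm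
  obtain ⟨b', hb'⟩ := he' ((prod.snd : A ⨯ B' ⟶ B').f x)
  obtain ⟨w, rfl, -⟩ := hpb.exists_of_isPullback (isPullback_prod_snd A e') hb'.symm
  refine ⟨w, ?_⟩
  rw [← comp_apply, prod.map_map, Category.id_comp, Category.comp_id]

/-- Each homomorphism is a surjection followed by the monomorphism with the same image; the product
of the surjections is surjective. -/
lemma range_prodMap {A A' B B' V V' : Coalgebra F} {f : A ⟶ B} {f' : A' ⟶ B'} {n : V ⟶ B}
    {n' : V' ⟶ B'} [Mono n] [Mono n'] (h : Set.range n.f = Set.range f.f)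
    (h' : Set.range n'.f = Set.range f'.f) :
    Set.range (prod.map n n').f = Set.range (prod.map f f').f := by
  have key {A B V : Coalgebra F} {f : A ⟶ B} {n : V ⟶ B} [Mono n]
      (h : Set.range n.f = Set.range f.f) : ∃ e : A ⟶ V, e ≫ n = f ∧ Function.Surjective e.f := by
    obtain ⟨e, rfl⟩ := hpb.exists_lift f n h.ge
    refine ⟨e, rfl, fun v => ?_⟩
    obtain ⟨a, ha⟩ := h.le (Set.mem_range_self v)
    exact ⟨a, hpb.injective_of_mono n ha⟩
  obtain ⟨e, rfl, he⟩ := key h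
  obtain ⟨e', rfl, he'⟩ := key h'
  have hmap : prod.map (e ≫ n) (e' ≫ n') = prod.map e e' ≫ prod.map n n' :=
    (prod.map_map _ _ _ _).symm
  rw [hmap]
  exact ((hpb.surjective_prodMap he he').range_comp (prod.map n n').f).symm

lemma isRange_prodHom {A A' B B' : Coalgebra F} (φ : (⟨A⟩ : Pfn F) ⟶ ⟨B⟩)
    (ψ : (⟨A'⟩ : Pfn F) ⟶ ⟨B'⟩) (ε : (⟨B⟩ : Pfn F) ⟶ ⟨B⟩) (δ : (⟨B'⟩ : Pfn F) ⟶ ⟨B'⟩)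
    (hε : (nearProduct (Coalgebra F)).IsRange φ ε) (hδ : (nearProduct (Coalgebra F)).IsRange ψ δ) :
    (nearProduct (Coalgebra F)).IsRange (prodHom φ ψ) (prodHom ε δ) := by
  induction φ using hom_cases with | h m φ
  induction ψ using hom_cases with | h n ψ
  rw [hpb.isRange_unique hε (hpb.isRange_partialHom_image m φ),
    hpb.isRange_unique hδ (hpb.isRange_partialHom_image n ψ)]
  exact hpb.isRange_partialHom (prod.map m n) (prod.map φ ψ) (prod.map _ _)
    (hpb.range_prodMap (Subcoalgebra.range_incl _) (Subcoalgebra.range_incl _))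

theorem isRPSigmaCategory : (nearProduct (Coalgebra F)).IsRPSigmaCategory where
  toIsPSigmaCategory := hpb.isPSigmaCategory
  exists_range {X Y} φ := by
    induction φ using hom_cases (A := X.of) (B := Y.of) with | h m φ
    exact ⟨_, hpb.isRange_partialHom_image m φ⟩
  range_map := hpb.isRange_prodHom

end WeaklyPreservesPullbacks

end Ranges

/-! ### The lattice of domains -/

section Dom

variable {F : Type u ⥤ Type u} [HasFiniteLimits (Coalgebra F)]

/-- The bijection between domains and subcoalgebras. -/
noncomputable def domEquiv (hpb : WeaklyPreservesPullbacks F) (X : Pfn F) :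
    (nearProduct (Coalgebra F)).Dom X ≃ Subcoalgebra X.of where
  toFun ε := domSubcoalgebra ε.1
  invFun U :=
    ⟨(nearProduct (Coalgebra F)).domain (homMk (X := X) (Y := X) U.incl U.incl), _, _, rfl⟩
  left_inv ε := Subtype.ext <| hpb.isDomain_ext ⟨_, _, rfl⟩ ε.2
    (domSubcoalgebra_domain_incl _)
  right_inv := domSubcoalgebra_domain_incl

/-- The lattice structure on the set of domains. -/
noncomputable abbrev domLattice (hpb : WeaklyPreservesPullbacks F) (X : Pfn F) :
    Lattice ((nearProduct (Coalgebra F)).Dom X) :=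
  letI := Subcoalgebra.lattice hpb X.of
  let e := domEquiv hpb X
  { PartialOrder.lift e e.injective with
    sup := fun ε δ => e.symm (e ε ⊔ e δ)
    inf := fun ε δ => e.symm (e ε ⊓ e δ)
    le_sup_left := fun _ _ => le_sup_left.trans_eq (e.apply_symm_apply _).symm
    le_sup_right := fun _ _ => le_sup_right.trans_eq (e.apply_symm_apply _).symm
    sup_le := fun _ _ _ h₁ h₂ => (e.apply_symm_apply _).trans_le (sup_le h₁ h₂)
    inf_le_left := fun _ _ => (e.apply_symm_apply _).trans_le inf_le_left
    inf_le_right := fun _ _ => (e.apply_symm_apply _).trans_le inf_le_right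
    le_inf := fun _ _ _ h₁ h₂ => (le_inf h₁ h₂).trans_eq (e.apply_symm_apply _).symm }

/-- A domain defined on the union of two domains is the range of their copairing. -/
lemma WeaklyPreservesPullbacks.isRange_copair (hpb : WeaklyPreservesPullbacks F) {A : Coalgebra F}
    {ε δ ζ : (⟨A⟩ : Pfn F) ⟶ ⟨A⟩} (hε : (nearProduct (Coalgebra F)).IsDomain ε)
    (hδ : (nearProduct (Coalgebra F)).IsDomain δ) (hζ : (nearProduct (Coalgebra F)).IsDomain ζ)
    (h : (domSubcoalgebra ζ).carrier =
      (domSubcoalgebra ε).carrier ∪ (domSubcoalgebra δ).carrier) [HasBinaryCoproducts (Pfn F)] :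
    (nearProduct (Coalgebra F)).IsRange (coprod.desc ε δ) ζ where
  isDomain := hζ
  comp_eq := by
    have key {η : (⟨A⟩ : Pfn F) ⟶ ⟨A⟩} (hη : (nearProduct (Coalgebra F)).IsDomain η)
        (hle : (domSubcoalgebra η).carrier ⊆ (domSubcoalgebra ζ).carrier) : η ≫ ζ = η :=
      hpb.graph_ext fun x y => by
        rw [hpb.graph_comp_isDomain hζ, graph_of_isDomain hη]
        exact and_iff_left_of_imp fun hxy => hxy.2 ▸ hle hxy.1
    -- The coproduct is used only through its universal property: both range axioms are tested on
    -- the two summands.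
    apply coprod.hom_ext
    · rw [coprod.inl_desc_assoc, coprod.inl_desc, key hε (h ▸ Set.subset_union_left)]
    · rw [coprod.inr_desc_assoc, coprod.inr_desc, key hδ (h ▸ Set.subset_union_right)]
  cancel {Z} ψ ψ' hψ := by
    have h₁ : ε ≫ ψ = ε ≫ ψ' := by
      simpa only [coprod.inl_desc_assoc] using congrArg (coprod.inl ≫ ·) hψ
    have h₂ : δ ≫ ψ = δ ≫ ψ' := by
      simpa only [coprod.inr_desc_assoc] using congrArg (coprod.inr ≫ ·) hψ
    refine hpb.graph_ext fun x z => ?_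
    rw [hpb.graph_comp_of_isDomain hζ, hpb.graph_comp_of_isDomain hζ, h]
    refine and_congr_right fun hx => ?_
    rcases hx with hx | hx
    · have := (hpb.graph_comp_of_isDomain hε ψ x z).symm
      rw [h₁, hpb.graph_comp_of_isDomain hε] at this
      simpa [hx] using this
    · have := (hpb.graph_comp_of_isDomain hδ ψ x z).symm
      rw [h₂, hpb.graph_comp_of_isDomain hδ] at this
      simpa [hx] using this

end Dom

end CoalgPfn

theorem mainTheorem4 (F : Type u ⥤ Type u) (hF : CoalgPfn.IsNontrivial F)
    (hpb : CoalgPfn.WeaklyPreservesPullbacks F)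
    (hba : CoalgPfn.IsBounded F ∨ Functor.IsAccessible.{u} F) :
    ∃ (_ : HasFiniteLimits (Endofunctor.Coalgebra F))
      (h : (CoalgPfn.Par.nearProduct (Endofunctor.Coalgebra F)).IsRPSigmaCategory),
      ∀ X : CoalgPfn.Pfn F,
        ∃ (_ : Lattice ((CoalgPfn.Par.nearProduct (Endofunctor.Coalgebra F)).Dom X))
          (e : (CoalgPfn.Par.nearProduct (Endofunctor.Coalgebra F)).Dom X ≃o
            CoalgPfn.Subcoalgebra X.of),
          (∀ ε δ : (CoalgPfn.Par.nearProduct (Endofunctor.Coalgebra F)).Dom X,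
            (ε ⊓ δ).1 = δ.1 ≫ ε.1 ∧
            (CoalgPfn.Par.nearProduct (Endofunctor.Coalgebra F)).IsRange
              (h.copair ε.1 δ.1) (ε ⊔ δ).1 ∧
            (e (ε ⊓ δ)).carrier = (e ε).carrier ∩ (e δ).carrier ∧
            (e (ε ⊔ δ)).carrier = (e ε).carrier ∪ (e δ).carrier) ∧
          (∀ ε, e ε = CoalgPfn.domSubcoalgebra ε.1) ∧
          (∀ U : CoalgPfn.Subcoalgebra X.of,
            (e.symm U).1 = (CoalgPfn.Par.nearProduct (Endofunctor.Coalgebra F)).domain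
              (CoalgPfn.Par.homMk (X := X) (Y := X) U.incl U.incl)) := by
  have := (hba.elim id CoalgPfn.isBounded_of_isAccessible).hasFiniteLimits
  refine ⟨this, hpb.isRPSigmaCategory, fun X => ⟨CoalgPfn.domLattice hpb X,
    ⟨CoalgPfn.domEquiv hpb X, Iff.rfl⟩, fun ε δ => ?_, fun _ => rfl, fun _ => rfl⟩⟩
  let := CoalgPfn.domLattice hpb X
  have hinf : (CoalgPfn.domSubcoalgebra (ε ⊓ δ).1).carrier =
      (CoalgPfn.domSubcoalgebra ε.1).carrier ∩ (CoalgPfn.domSubcoalgebra δ.1).carrier :=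
    (congrArg CoalgPfn.Subcoalgebra.carrier
      ((CoalgPfn.domEquiv hpb X).apply_symm_apply _)).trans
        (CoalgPfn.Subcoalgebra.exists_inter hpb _ _).choose_spec
  have hsup : (CoalgPfn.domSubcoalgebra (ε ⊔ δ).1).carrier =
      (CoalgPfn.domSubcoalgebra ε.1).carrier ∪ (CoalgPfn.domSubcoalgebra δ.1).carrier :=
    congrArg CoalgPfn.Subcoalgebra.carrier ((CoalgPfn.domEquiv hpb X).apply_symm_apply _)
  have := hpb.isPSigmaCategory.hasBinaryCoproducts
  refine ⟨?_, hpb.isRange_copair ε.2 δ.2 (ε ⊔ δ).2 hsup, hinf, hsup⟩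
  -- Both sides are restrictions of the identity relation, to the intersection of the two
  -- subcoalgebras.
  refine hpb.graph_ext fun x y => ?_
  rw [CoalgPfn.graph_of_isDomain (ε ⊓ δ).2, hinf, hpb.graph_comp_of_isDomain δ.2,
    CoalgPfn.graph_of_isDomain ε.2, Set.mem_inter_iff, and_left_comm, and_assoc]
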